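/- Let $p$ be a prime and let $h_1,h_2\ge 1$ be coprime integers. Write $X=(x_1,x_2)$, $Y=(y_1,y_2)$ and $X^{m}=(x_1^{m},x_2^{m})$. Let $L=(L_1,L_2)\in\mathbb{Q}_p[[X]]^2$ be the unique pair of power series satisfying the functional equation $L(X)=X+\sum_{i\ge 1}s_i\,L(X^{p^i})$, where $s_i$ is the $2\times 2$ matrix whose $(1,2)$ entry is $p^{-1}$ if $i=h_1$, whose $(2,1)$ entry is $p^{-1}$ if $i=h_2$, and all of whose other entries are $0$; that is, $$L_1(x_1,x_2)=x_1+p^{-1}L_2(x_1^{p^{h_1}},x_2^{p^{h_1}}),\qquad L_2(x_1,x_2)=x_2+p^{-1}L_1(x_1^{p^{h_2}},x_2^{p^{h_2}}).$$ Let $F(X,Y)=L^{-1}(L(X)+L(Y))$, where $L^{-1}$ is the inverse of $L$ for composition (the $2$-dimensional Lubin–Tate formal group attached to $(h_1,h_2)$). Then $F$ has coefficients in $\mathbb{Z}_p$ and is a $2$-dimensional formal group over $\mathbb{Z}_p$. Let $[p]_F$ be multiplication by $p$ in $F$, where $[1]_F(X)=X$ and $[k]_F(X)=F(X,[k-1]_F(X))$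 for $k\ge 2$. Then $[p]_F$ is an endomorphism of $F$ over $\mathbb{Z}_p$, and $$[p]_F(x_1,x_2)\equiv(px_1,px_2)\ \text{ modulo terms of degree}\ge 2,\qquad [p]_F(x_1,x_2)\equiv\bigl(x_2^{p^{h_1}},x_1^{p^{h_2}}\bigr)\ \text{ mod } p.$$ In particular $[p]_F\in\mathcal{C}_{LT}^{h_1,h_2}\subset\mathcal{C}_{LT}$. Here $\mathcal{C}_{LT}^{k,\ell}$ is the set of $f\in\mathbb{Z}_p[[X]]^2$ such that $f\equiv(px_1,px_2)$ modulo terms of degree $\ge 2$ and $f \bmod p$ is $(x_1^{p^k},x_2^{p^\ell})$ or $(x_2^{p^k},x_1^{p^\ell})$, and $\mathcal{C}_{LT}$ is the union of the $\mathcal{C}_{LT}^{k,\ell}$ over all pairs of coprime positive integers $(k,\ell)$. Moreover $F$ has height $h_1+h_2$: if $H_1,H_2\in\mathbb{F}_p[[x_1,x_2]]$ are the components of multiplication by $p$ in the reduction of $F$ modulo $p$, then $\mathbb{F}_p[[x_1,x_2]]$ is a finitely generated free module of rank $p^{h_1+h_2}$ over its subring $\mathbb{F}_p[[H_1,H_2]]$.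 -/

import Mathlib

noncomputable section

namespace LubinTateTwo

open MvPowerSeries

/-! ### Tuples of power series -/

/-- The composite `f(a)` of a tuple `f` of power series with a tuple `a` of power series
(used when the constant terms of `a` vanish). -/
def comp {ι σ τ R : Type*} [CommRing R] (f : ι → MvPowerSeries σ R)
    (a : σ → MvPowerSeries τ R) : ι → MvPowerSeries τ R :=
  fun i => (f i).subst a

/-- Apply a ring homomorphism to all the coefficients of a tuple of power series. -/
def mapCoeff {ι σ R S : Type*} [CommRing R] [CommRing S] (φ : R →+* S)
    (f : ι → MvPowerSeries σ R) : ι → MvPowerSeries σ S :=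
  fun i => MvPowerSeries.map φ (f i)

/-- `f ≡ g` modulo terms of total degree at least `2`. -/
def CongrModDegTwo {ι σ R : Type*} [CommRing R] (f g : ι → MvPowerSeries σ R) : Prop :=
  ∀ (i : ι) (d : σ →₀ ℕ), d.degree < 2 → coeff d (f i) = coeff d (g i)

/-- `f ≡ g` modulo the ideal generated by `r`, coefficient by coefficient. -/
def CongrMod {ι σ R : Type*} [CommRing R] (r : R) (f g : ι → MvPowerSeries σ R) : Prop :=
  ∀ (i : ι) (d : σ →₀ ℕ), r ∣ coeff d (f i) - coeff d (g i)

/-! ### Formal groups of dimension `n` -/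

/-- `A +_F B = F(A, B)`; the variables `x_i` of `F(X, Y)` are indexed by `Sum.inl i`, the
variables `y_i` by `Sum.inr i`. -/
def fadd {n : ℕ} {τ R : Type*} [CommRing R] (F : Fin n → MvPowerSeries (Fin n ⊕ Fin n) R)
    (A B : Fin n → MvPowerSeries τ R) : Fin n → MvPowerSeries τ R :=
  comp F (Sum.elim A B)

/-- `F(X, Y)` is an `n`-dimensional formal group over `R`. -/
structure IsFormalGroup {n : ℕ} {R : Type*} [CommRing R]
    (F : Fin n → MvPowerSeries (Fin n ⊕ Fin n) R) : Prop where
  /-- `F(X, Y) ≡ X + Y` modulo degree `2`. -/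
  linear : CongrModDegTwo F (fun i => X (Sum.inl i) + X (Sum.inr i))
  /-- `F(F(X, Y), Z) = F(X, F(Y, Z))`. -/
  assoc :
    fadd (τ := Fin n ⊕ Fin n ⊕ Fin n) F
        (fadd F (fun i => X (Sum.inl i)) (fun i => X (Sum.inr (Sum.inl i))))
        (fun i => X (Sum.inr (Sum.inr i))) =
      fadd F (fun i => X (Sum.inl i))
        (fadd F (fun i => X (Sum.inr (Sum.inl i))) (fun i => X (Sum.inr (Sum.inr i))))
  /-- `F(X, 0) = X`. -/
  add_zero : fadd F (X : Fin n → MvPowerSeries (Fin n) R) 0 = X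
  /-- `F(0, X) = X`. -/
  zero_add : fadd F 0 (X : Fin n → MvPowerSeries (Fin n) R) = X
  /-- There is a unique `ι(X)` (without constant term, so that it can be substituted) such that
  `F(X, ι(X)) = 0 = F(ι(X), X)`. -/
  inverse : ∃! ι : Fin n → MvPowerSeries (Fin n) R,
    (∀ i, constantCoeff (ι i) = 0) ∧ fadd F X ι = 0 ∧ fadd F ι X = 0

/-- Multiplication by a natural number `k`: `[0]_F(X) = 0`, `[1]_F(X) = X` and
`[k]_F(X) = F(X, [k-1]_F(X))` for `k ≥ 2`. -/
def mulBy {n : ℕ} {R : Type*} [CommRing R] (F : Fin n → MvPowerSeries (Fin n ⊕ Fin n) R) :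
    ℕ → Fin n → MvPowerSeries (Fin n) R
  | 0 => 0
  | 1 => X
  | k + 2 => fadd F X (mulBy F (k + 1))

/-- `f` is an endomorphism of the formal group `F`: it has no constant term and
`f(F(X, Y)) = F(f(X), f(Y))`. -/
def IsEndomorphism {n : ℕ} {R : Type*} [CommRing R]
    (F : Fin n → MvPowerSeries (Fin n ⊕ Fin n) R) (f : Fin n → MvPowerSeries (Fin n) R) : Prop :=
  (∀ i, constantCoeff (f i) = 0) ∧
    comp f F = fadd F (comp f fun i => X (Sum.inl i)) (comp f fun i => X (Sum.inr i))

/-- A formal group `F` over a field `k` of characteristic `p`, with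
`[p]_F(X) = (H_1(X), …, H_n(X))`, has (finite) height `h`: the ring `k[[x_1, …, x_n]]` is a
finitely generated free module of rank `p ^ h` over its subring `k[[H_1(X), …, H_n(X)]]`. -/
def HasHeightField {n : ℕ} {k : Type*} [Field k] (p : ℕ)
    (F : Fin n → MvPowerSeries (Fin n ⊕ Fin n) k) (h : ℕ) : Prop :=
  ∃ hH : HasSubst (mulBy F p),
    Module.Finite (substAlgHom (R := k) hH).range (MvPowerSeries (Fin n) k) ∧
    Module.Free (substAlgHom (R := k) hH).range (MvPowerSeries (Fin n) k) ∧
    Module.finrank (substAlgHom (R := k) hH).range (MvPowerSeries (Fin n) k) = p ^ h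

/-- A formal group over a local ring with residue field of characteristic `p` has height `h`
when its reduction over the residue field has height `h`. -/
def HasHeight {n : ℕ} {R : Type*} [CommRing R] [IsLocalRing R] (p : ℕ)
    (F : Fin n → MvPowerSeries (Fin n ⊕ Fin n) R) (h : ℕ) : Prop :=
  HasHeightField p (mapCoeff (IsLocalRing.residue R) F) h

/-! ### The sets `C_LT` -/

/-- `C_LT^{k,l}`: the pairs `f` of power series over `ℤ_p` with `f ≡ (p x_1, p x_2)` modulo
degree `2` and `f` modulo `p` equal to `(x_1^{p^k}, x_2^{p^l})` or `(x_2^{p^k}, x_1^{p^l})`. -/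
def CLT (p : ℕ) [Fact p.Prime] (k l : ℕ) : Set (Fin 2 → MvPowerSeries (Fin 2) ℤ_[p]) :=
  {f | CongrModDegTwo f (fun i => C (p : ℤ_[p]) * X i) ∧
    (CongrMod (p : ℤ_[p]) f ![X 0 ^ p ^ k, X 1 ^ p ^ l] ∨
      CongrMod (p : ℤ_[p]) f ![X 1 ^ p ^ k, X 0 ^ p ^ l])}

/-- `C_LT`: the union of the `C_LT^{k,l}` over the pairs of coprime positive integers. -/
def CLTUnion (p : ℕ) [Fact p.Prime] : Set (Fin 2 → MvPowerSeries (Fin 2) ℤ_[p]) :=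
  {f | ∃ k l : ℕ, 0 < k ∧ 0 < l ∧ Nat.Coprime k l ∧ f ∈ CLT p k l}

/-! ### The logarithm and the two-dimensional Lubin–Tate formal group -/

/-- The matrices `s_i`: the entry `(1,2)` of `s_{h₁}` and the entry `(2,1)` of `s_{h₂}` are
`p⁻¹`, and all other entries of all `s_i` are `0`. (If `h₁ = h₂`, both entries of that one
matrix are `p⁻¹`.) -/
def sMatrix (p : ℕ) [Fact p.Prime] (h₁ h₂ i : ℕ) : Matrix (Fin 2) (Fin 2) ℚ_[p] :=
  !![0, if i = h₁ then (p : ℚ_[p])⁻¹ else 0; if i = h₂ then (p : ℚ_[p])⁻¹ else 0, 0]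

/-- The functional equation `L(X) = X + ∑_{i ≥ 1} s_i L(X^{p^i})`, in which only finitely many
`s_i` are nonzero. -/
def FunctionalEquation (p : ℕ) [Fact p.Prime] (h₁ h₂ : ℕ)
    (L : Fin 2 → MvPowerSeries (Fin 2) ℚ_[p]) : Prop :=
  ∀ a : Fin 2, L a = X a + ∑ᶠ (i : ℕ) (_ : 1 ≤ i),
    ∑ b : Fin 2, sMatrix p h₁ h₂ i a b • (L b).subst (fun j : Fin 2 => X j ^ p ^ i :
      Fin 2 → MvPowerSeries (Fin 2) ℚ_[p])

theorem coeff_subst_pow_congr {K : Type*} [CommRing K] {q : ℕ} (hq : 2 ≤ q) {k : ℕ}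
    {f g : MvPowerSeries (Fin 2) K} (hfg : ∀ d, d.degree ≤ k → coeff d f = coeff d g)
    (d : Fin 2 →₀ ℕ) (hd : d.degree ≤ k + 1) :
    coeff d (f.subst (fun j : Fin 2 => X j ^ q : Fin 2 → MvPowerSeries (Fin 2) K)) =
      coeff d (g.subst (fun j : Fin 2 => X j ^ q : Fin 2 → MvPowerSeries (Fin 2) K)) := by
  have hq0 : q ≠ 0 := by omega
  have key : ∀ φ : MvPowerSeries (Fin 2) K,
      φ.subst (fun j : Fin 2 => X j ^ q : Fin 2 → MvPowerSeries (Fin 2) K) = expand q hq0 φ := by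
    intro φ
    rw [expand, substAlgHom_apply]
  rw [key, key]
  by_cases h : ∀ j, q ∣ d j
  · obtain ⟨m, rfl⟩ : ∃ m : Fin 2 →₀ ℕ, d = q • m := by
      refine ⟨Finsupp.equivFunOnFinite.symm fun j => d j / q, ?_⟩
      ext j
      simp [Nat.mul_div_cancel' (h j)]
    rw [coeff_expand_smul, coeff_expand_smul]
    apply hfg
    rw [map_nsmul, smul_eq_mul] at hd
    nlinarith
  · push Not at h
    obtain ⟨j, hj⟩ := h
    rw [coeff_expand_of_not_dvd q hq0 f hj, coeff_expand_of_not_dvd q hq0 g hj]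

/-- The functional equation written out as a system of two equations. -/
theorem functionalEquation_iff (p : ℕ) [Fact p.Prime] {h₁ h₂ : ℕ} (hh₁ : 0 < h₁) (hh₂ : 0 < h₂)
    (L : Fin 2 → MvPowerSeries (Fin 2) ℚ_[p]) :
    FunctionalEquation p h₁ h₂ L ↔
      L 0 = X 0 + (p : ℚ_[p])⁻¹ • (L 1).subst (fun j : Fin 2 => X j ^ p ^ h₁ :
          Fin 2 → MvPowerSeries (Fin 2) ℚ_[p]) ∧
      L 1 = X 1 + (p : ℚ_[p])⁻¹ • (L 0).subst (fun j : Fin 2 => X j ^ p ^ h₂ :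
          Fin 2 → MvPowerSeries (Fin 2) ℚ_[p]) := by
  unfold FunctionalEquation
  rw [Fin.forall_fin_two]
  refine and_congr ?_ ?_
  · rw [finsum_eq_single _ h₁, finsum_eq_if, if_pos (by omega : 1 ≤ h₁)]
    · simp [sMatrix]
    · intro i hi
      simp [sMatrix, hi]
  · rw [finsum_eq_single _ h₂, finsum_eq_if, if_pos (by omega : 1 ≤ h₂)]
    · simp [sMatrix]
    · intro i hi
      simp [sMatrix, hi]

theorem functionalEquation_existsUnique (p : ℕ) [Fact p.Prime] {h₁ h₂ : ℕ} (hh₁ : 0 < h₁)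
    (hh₂ : 0 < h₂) : ∃! L, FunctionalEquation p h₁ h₂ L := by
  have hp : 2 ≤ p := (Fact.out : p.Prime).two_le
  have hq₁ : 2 ≤ p ^ h₁ := hp.trans (Nat.le_self_pow hh₁.ne' p)
  have hq₂ : 2 ≤ p ^ h₂ := hp.trans (Nat.le_self_pow hh₂.ne' p)
  let T : (Fin 2 → MvPowerSeries (Fin 2) ℚ_[p]) → Fin 2 → MvPowerSeries (Fin 2) ℚ_[p] := fun L =>
    ![X 0 + (p : ℚ_[p])⁻¹ • (L 1).subst (fun j : Fin 2 => X j ^ p ^ h₁ :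
          Fin 2 → MvPowerSeries (Fin 2) ℚ_[p]),
      X 1 + (p : ℚ_[p])⁻¹ • (L 0).subst (fun j : Fin 2 => X j ^ p ^ h₂ :
          Fin 2 → MvPowerSeries (Fin 2) ℚ_[p])]
  have hT : ∀ L, FunctionalEquation p h₁ h₂ L ↔ L = T L := by
    intro L
    rw [functionalEquation_iff p hh₁ hh₂, funext_iff, Fin.forall_fin_two]
    rfl
  have hstep : ∀ (k : ℕ) (L M : Fin 2 → MvPowerSeries (Fin 2) ℚ_[p]),
      (∀ a d, d.degree ≤ k → coeff d (L a) = coeff d (M a)) →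
      ∀ a d, d.degree ≤ k + 1 → coeff d (T L a) = coeff d (T M a) := by
    intro k L M h a d hd
    fin_cases a
    · simp [T, coeff_subst_pow_congr hq₁ (h 1) d hd]
    · simp [T, coeff_subst_pow_congr hq₂ (h 0) d hd]
  have hconst : ∀ L : Fin 2 → MvPowerSeries (Fin 2) ℚ_[p],
      constantCoeff (T L 0) = (p : ℚ_[p])⁻¹ * constantCoeff (L 1) ∧
      constantCoeff (T L 1) = (p : ℚ_[p])⁻¹ * constantCoeff (L 0) := by
    intro L
    have key : ∀ (q : ℕ) (_ : q ≠ 0) (φ : MvPowerSeries (Fin 2) ℚ_[p]), constantCoeff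
        (φ.subst (fun j : Fin 2 => X j ^ q : Fin 2 → MvPowerSeries (Fin 2) ℚ_[p])) =
          constantCoeff φ := by
      intro q hq φ
      have := constantCoeff_expand q hq φ
      rwa [expand, substAlgHom_apply] at this
    constructor
    · simp [T, smul_eq_C_mul, key (p ^ h₁) (by omega) (L 1)]
    · simp [T, smul_eq_C_mul, key (p ^ h₂) (by omega) (L 0)]
  have hzero : ∀ L, L = T L → ∀ a, constantCoeff (L a) = 0 := by
    intro L hL
    have h := hconst L
    rw [← hL] at h
    obtain ⟨h0, h1⟩ := h
    have hp1 : (p : ℚ_[p]) ≠ 0 := by exact_mod_cast (by omega : p ≠ 0)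
    have hp2 : (p : ℚ_[p]) * p - 1 ≠ 0 := by
      intro h
      have h2 : ((p * p : ℕ) : ℚ_[p]) = ((1 : ℕ) : ℚ_[p]) := by
        push_cast
        exact sub_eq_zero.mp h
      have := Nat.cast_injective h2
      nlinarith
    have e0 : constantCoeff (L 0) = 0 := by
      rw [h1] at h0
      field_simp at h0
      have : ((p : ℚ_[p]) * p - 1) * constantCoeff (L 0) = 0 := by linear_combination h0
      exact (mul_eq_zero.mp this).resolve_left hp2
    have e1 : constantCoeff (L 1) = 0 := by rw [h1, e0, mul_zero]
    exact Fin.forall_fin_two.mpr ⟨e0, e1⟩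
  let S : ℕ → Fin 2 → MvPowerSeries (Fin 2) ℚ_[p] := fun k => T^[k] 0
  have hS : ∀ k, S (k + 1) = T (S k) := fun k => Function.iterate_succ_apply' T k 0
  have hS1 : ∀ k a (d : Fin 2 →₀ ℕ), d.degree ≤ k →
      coeff d (S k a) = coeff d (S (k + 1) a) := by
    intro k
    induction k with
    | zero =>
      intro a d hd
      have hd0 : d = 0 := (Finsupp.degree_eq_zero_iff d).mp (Nat.le_zero.mp hd)
      have h := hconst 0
      subst hd0
      rw [hS]
      fin_cases a
      · simpa [S] using h.1.symm
      · simpa [S] using h.2.symm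
    | succ k ih =>
      intro a d hd
      rw [hS k, hS (k + 1)]
      exact hstep k _ _ ih a d hd
  have hS2 : ∀ k l a (d : Fin 2 →₀ ℕ), d.degree ≤ k → k ≤ l →
      coeff d (S l a) = coeff d (S k a) := by
    intro k l a d hd hkl
    induction l, hkl using Nat.le_induction with
    | base => rfl
    | succ l hl ih => rw [← hS1 l a d (hd.trans hl), ih]
  let L : Fin 2 → MvPowerSeries (Fin 2) ℚ_[p] := fun a d => coeff d (S d.degree a)
  have hLS : ∀ k a (d : Fin 2 →₀ ℕ), d.degree ≤ k → coeff d (L a) = coeff d (S k a) := by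
    intro k a d hd
    rw [hS2 d.degree k a d le_rfl hd]
    rfl
  have hLT : L = T L := by
    funext a
    ext d
    rw [hLS (d.degree + 1) a d (by omega), hS]
    exact (hstep d.degree L (S d.degree) (fun b e he => hLS _ b e he) a d (by omega)).symm
  refine ⟨L, (hT _).mpr hLT, ?_⟩
  · intro M hM
    have hMT := (hT M).mp hM
    have hall : ∀ k a (d : Fin 2 →₀ ℕ), d.degree ≤ k → coeff d (M a) = coeff d (L a) := by
      intro k
      induction k with
      | zero =>
        intro a d hd
        have hd0 : d = 0 := (Finsupp.degree_eq_zero_iff d).mp (Nat.le_zero.mp hd)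
        subst hd0
        rw [coeff_zero_eq_constantCoeff_apply, coeff_zero_eq_constantCoeff_apply,
          hzero M hMT, hzero L hLT]
      | succ k ih =>
        intro a d hd
        rw [hMT, hLT]
        exact hstep k M L ih a d hd
    funext a
    ext d
    exact hall d.degree a d le_rfl

/-- The logarithm `L`: the unique solution of the functional equation. -/
def logarithm (p : ℕ) [Fact p.Prime] {h₁ h₂ : ℕ} (hh₁ : 0 < h₁) (hh₂ : 0 < h₂) :
    Fin 2 → MvPowerSeries (Fin 2) ℚ_[p] :=
  (functionalEquation_existsUnique p hh₁ hh₂).choose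

/-- `M` is the two-sided inverse of `L` for composition: `M` has no constant term and
`L(M(X)) = X = M(L(X))`. -/
def IsCompInverse {n : ℕ} {K : Type*} [CommRing K] (L M : Fin n → MvPowerSeries (Fin n) K) :
    Prop :=
  (∀ i, constantCoeff (M i) = 0) ∧ comp L M = X ∧ comp M L = X

open Classical in
/-- The inverse `L⁻¹` for composition (with the value `0` if there is none). -/
def compInverse {n : ℕ} {K : Type*} [CommRing K] (L : Fin n → MvPowerSeries (Fin n) K) :
    Fin n → MvPowerSeries (Fin n) K :=
  if h : ∃ M, IsCompInverse L M then h.choose else 0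

/-- The two-dimensional Lubin–Tate formal group `F(X, Y) = L⁻¹(L(X) + L(Y))` attached to
`(h₁, h₂)`, as a pair of power series with coefficients in `ℚ_p`. -/
def lubinTateGroup (p : ℕ) [Fact p.Prime] {h₁ h₂ : ℕ} (hh₁ : 0 < h₁) (hh₂ : 0 < h₂) :
    Fin 2 → MvPowerSeries (Fin 2 ⊕ Fin 2) ℚ_[p] :=
  comp (compInverse (logarithm p hh₁ hh₂))
    (comp (logarithm p hh₁ hh₂) (fun i => X (Sum.inl i)) +
      comp (logarithm p hh₁ hh₂) (fun i => X (Sum.inr i)))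

end LubinTateTwo

end

noncomputable section

namespace LubinTateTwo

open MvPowerSeries

section General

variable {ι σ τ υ R S : Type*} [CommRing R] [CommRing S]

/-! ### Composition of tuples of power series -/

/-! Both equations for the logarithm have the shape `L_a = X_a + p⁻¹ L_{π(a)}(X^{q_a})` with `q_a =
p^{h(a)}`, where `π` is the swap of the two indices. Everything except the final specialisation is
proved for such an `L` (`IsTwistedLog`) on a finite index set.

Since `q_a ≥ 2`, the term `L_{π(a)}(G^{q_a})` in degrees at most `n` depends only on `G` in degrees
below `n`. Hence `L(G) = V` has exactly one solution `G` without constant term, found degree by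
degree. So `L` is invertible for composition, and identities between such tuples may be checked
after applying `L`.

Integrality is Hazewinkel's functional equation lemma (`exists_integral`). Congruence modulo `p`
improves under `p^k`-th powers, to a congruence modulo `p^{k+1}`, and this pays for the factor
`p⁻¹`. For `V = L(X) + L(Y)` the defect `V_a - p⁻¹ V_{π(a)}(X^{q_a}, Y^{q_a})` is just `X_a + Y_a`,
so `F` is integral. Under `L` the group axioms and the properties of `[p]_F` become additive
identities.

For the reduction of `[p]_F`, put `φ(X)_a = X_{π(a)}^{q_a}`. Then `L([p]_F) = pL = pX + L(φ)`
(`comp_twist`), so `L([p]_F) ≡ L(φ)` modulo `p`, and `dvd_sub_of_comp_sub_mem` gives `[p]_F ≡ φ`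
modulo `p`. The height is then a count of monomials: division with remainder of exponents by the
`q_a` gives a basis of `∏ q_a` elements. -/

theorem comp_comp {f : ι → MvPowerSeries σ R} {a : σ → MvPowerSeries τ R}
    {b : τ → MvPowerSeries υ R} (ha : HasSubst a) (hb : HasSubst b) :
    comp (comp f a) b = comp f (comp a b) :=
  funext fun _ => subst_comp_subst_apply ha hb _

theorem X_comp {a : σ → MvPowerSeries τ R} (ha : HasSubst a) :
    comp (X : σ → MvPowerSeries σ R) a = a :=
  funext fun _ => subst_X ha _

theorem comp_X (f : ι → MvPowerSeries σ R) : comp f X = f :=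
  funext fun i => congrFun subst_self (f i)

theorem add_comp {f g : ι → MvPowerSeries σ R} {a : σ → MvPowerSeries τ R} (ha : HasSubst a) :
    comp (f + g) a = comp f a + comp g a :=
  funext fun _ => subst_add ha _ _

theorem nsmul_comp {f : ι → MvPowerSeries σ R}
    {a : σ → MvPowerSeries τ R} (ha : HasSubst a) (k : ℕ) : comp (k • f) a = k • comp f a := by
  funext i
  change subst a (k • f i) = k • subst a (f i)
  rw [← substAlgHom_apply ha, map_nsmul, substAlgHom_apply]

theorem comp_sumElim_inl {a b : σ → MvPowerSeries τ R} (h : HasSubst (Sum.elim a b)) :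
    comp (fun i => X (Sum.inl i) : σ → MvPowerSeries (σ ⊕ σ) R) (Sum.elim a b) = a :=
  funext fun _ => subst_X h _

theorem comp_sumElim_inr {a b : σ → MvPowerSeries τ R} (h : HasSubst (Sum.elim a b)) :
    comp (fun i => X (Sum.inr i) : σ → MvPowerSeries (σ ⊕ σ) R) (Sum.elim a b) = b :=
  funext fun _ => subst_X h _

theorem mapCoeff_comp (φ : R →+* S) (f : ι → MvPowerSeries σ R) {a : σ → MvPowerSeries τ R}
    (ha : HasSubst a) : mapCoeff φ (comp f a) = comp (mapCoeff φ f) (mapCoeff φ a) :=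
  funext fun _ => map_subst ha _

theorem mapCoeff_X (φ : R →+* S) :
    mapCoeff φ (X : σ → MvPowerSeries σ R) = (X : σ → MvPowerSeries σ S) :=
  funext fun _ => map_X _ _

theorem mapCoeff_sumElim (φ : R →+* S) (a b : σ → MvPowerSeries τ R) :
    mapCoeff φ (Sum.elim a b) = Sum.elim (mapCoeff φ a) (mapCoeff φ b) := by
  funext i
  cases i <;> rfl

theorem mapCoeff_injective {φ : R →+* S} (hφ : Function.Injective φ) :
    Function.Injective (mapCoeff φ : (ι → MvPowerSeries σ R) → _) := by
  intro f g h
  funext i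
  ext d
  apply hφ
  rw [← coeff_map, ← coeff_map]
  exact congrArg (coeff d) (congrFun h i)

/-- A tuple of power series without constant terms. -/
def NoConst (a : ι → MvPowerSeries τ R) : Prop :=
  ∀ i, constantCoeff (a i) = 0

namespace NoConst

theorem hasSubst [Finite σ] {a : σ → MvPowerSeries τ R} (ha : NoConst a) : HasSubst a :=
  hasSubst_of_constantCoeff_zero ha

theorem X : NoConst (MvPowerSeries.X : τ → MvPowerSeries τ R) :=
  fun _ => constantCoeff_X _

theorem X_apply (e : ι → τ) : NoConst (fun i => MvPowerSeries.X (e i) : ι → MvPowerSeries τ R) :=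
  fun _ => constantCoeff_X _

theorem zero : NoConst (0 : ι → MvPowerSeries τ R) :=
  fun _ => map_zero _

theorem add {a b : ι → MvPowerSeries τ R} (ha : NoConst a) (hb : NoConst b) : NoConst (a + b) :=
  fun i => by simp [ha i, hb i]

theorem neg {a : ι → MvPowerSeries τ R} (ha : NoConst a) : NoConst (-a) :=
  fun i => by simp [ha i]

theorem sumElim {a : ι → MvPowerSeries τ R} {b : σ → MvPowerSeries τ R} (ha : NoConst a)
    (hb : NoConst b) : NoConst (Sum.elim a b) := by
  rintro (i | i)
  exacts [ha i, hb i]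

theorem comp [Finite σ] {f : ι → MvPowerSeries σ R} {a : σ → MvPowerSeries τ R} (hf : NoConst f)
    (ha : NoConst a) : NoConst (comp f a) :=
  fun i => constantCoeff_subst_eq_zero ha.hasSubst ha (hf i)

theorem pow {a : ι → MvPowerSeries τ R} (ha : NoConst a) {q : ℕ} (hq : q ≠ 0) :
    NoConst (fun i => a i ^ q) :=
  fun i => by simp [ha i, hq]

theorem map {a : ι → MvPowerSeries τ R} (ha : NoConst a) (φ : R →+* S) : NoConst (mapCoeff φ a) :=
  fun i => by simp [mapCoeff, ha i]

theorem of_map {a : ι → MvPowerSeries τ R} {φ : R →+* S} (hφ : Function.Injective φ)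
    (ha : NoConst (mapCoeff φ a)) : NoConst a := by
  intro i
  have h := ha i
  rw [mapCoeff, constantCoeff_map] at h
  exact hφ (by rw [h, map_zero])

end NoConst

theorem comp_zero [Finite σ] {f : ι → MvPowerSeries σ R} (hf : NoConst f) :
    comp f (0 : σ → MvPowerSeries τ R) = 0 :=
  funext fun i => subst_zero_of_constantCoeff_zero (hf i)

theorem comp_fadd {n : ℕ} {F : Fin n → MvPowerSeries (Fin n ⊕ Fin n) R}
    (L : ι → MvPowerSeries (Fin n) R) (hF : NoConst F) {A B : Fin n → MvPowerSeries τ R}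
    (hA : NoConst A) (hB : NoConst B) :
    comp L (fadd F A B) = comp (comp L F) (Sum.elim A B) := by
  rw [fadd, comp_comp hF.hasSubst (hA.sumElim hB).hasSubst]

theorem mapCoeff_fadd {n : ℕ} (φ : R →+* S) (F : Fin n → MvPowerSeries (Fin n ⊕ Fin n) R)
    {A B : Fin n → MvPowerSeries τ R} (hA : NoConst A) (hB : NoConst B) :
    mapCoeff φ (fadd F A B) = fadd (mapCoeff φ F) (mapCoeff φ A) (mapCoeff φ B) := by
  rw [fadd, mapCoeff_comp φ F (hA.sumElim hB).hasSubst, mapCoeff_sumElim, fadd]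

theorem NoConst.fadd {n : ℕ} {F : Fin n → MvPowerSeries (Fin n ⊕ Fin n) R} (hF : NoConst F)
    {A B : Fin n → MvPowerSeries τ R} (hA : NoConst A) (hB : NoConst B) :
    NoConst (fadd F A B) :=
  hF.comp (hA.sumElim hB)

theorem NoConst.mulBy {n : ℕ} {F : Fin n → MvPowerSeries (Fin n ⊕ Fin n) R} (hF : NoConst F) :
    ∀ k, NoConst (mulBy F k)
  | 0 => NoConst.zero
  | 1 => NoConst.X
  | k + 2 => hF.fadd NoConst.X (NoConst.mulBy hF (k + 1))

theorem mapCoeff_mulBy {n : ℕ} (φ : R →+* S) {F : Fin n → MvPowerSeries (Fin n ⊕ Fin n) R}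
    (hF : NoConst F) : ∀ k, mapCoeff φ (mulBy F k) = mulBy (mapCoeff φ F) k
  | 0 => funext fun _ => map_zero _
  | 1 => mapCoeff_X φ
  | k + 2 => by
    rw [mulBy, mapCoeff_fadd φ F NoConst.X (hF.mulBy (k + 1)), mapCoeff_mulBy φ hF (k + 1),
      mapCoeff_X, mulBy]

/-! ### Agreement in low degrees -/

/-- `f` and `g` have the same coefficients in all degrees below `n`. -/
def AgreeBelow (n : ℕ) (f g : MvPowerSeries τ R) : Prop :=
  ∀ d : τ →₀ ℕ, d.degree < n → coeff d f = coeff d g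

theorem agreeBelow_iff_le_order {n : ℕ} {f g : MvPowerSeries τ R} :
    AgreeBelow n f g ↔ n ≤ (f - g).order := by
  constructor
  · intro h
    exact nat_le_order fun d hd => by rw [map_sub, h d hd, sub_self]
  · intro h d hd
    rw [← sub_eq_zero, ← map_sub]
    exact coeff_of_lt_order (lt_of_lt_of_le (by exact_mod_cast hd) h)

namespace AgreeBelow

theorem refl (n : ℕ) (f : MvPowerSeries τ R) : AgreeBelow n f f := fun _ _ => rfl

theorem symm {n : ℕ} {f g : MvPowerSeries τ R} (h : AgreeBelow n f g) : AgreeBelow n g f :=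
  fun d hd => (h d hd).symm

theorem trans {n : ℕ} {f g k : MvPowerSeries τ R} (h : AgreeBelow n f g) (h' : AgreeBelow n g k) :
    AgreeBelow n f k :=
  fun d hd => (h d hd).trans (h' d hd)

theorem mono {m n : ℕ} (hmn : m ≤ n) {f g : MvPowerSeries τ R} (h : AgreeBelow n f g) :
    AgreeBelow m f g :=
  fun d hd => h d (hd.trans_le hmn)

theorem add {n : ℕ} {f g f' g' : MvPowerSeries τ R} (h : AgreeBelow n f g)
    (h' : AgreeBelow n f' g') : AgreeBelow n (f + f') (g + g') :=
  fun d hd => by rw [map_add, map_add, h d hd, h' d hd]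

theorem sub {n : ℕ} {f g f' g' : MvPowerSeries τ R} (h : AgreeBelow n f g)
    (h' : AgreeBelow n f' g') : AgreeBelow n (f - f') (g - g') :=
  fun d hd => by rw [map_sub, map_sub, h d hd, h' d hd]

theorem smul {n : ℕ} {f g : MvPowerSeries τ R} (c : R) (h : AgreeBelow n f g) :
    AgreeBelow n (c • f) (c • g) :=
  fun d hd => by rw [coeff_smul, coeff_smul, h d hd]

theorem one {f g : MvPowerSeries τ R} (hf : constantCoeff f = 0) (hg : constantCoeff g = 0) :
    AgreeBelow 1 f g := by
  intro d hd
  obtain rfl := (Finsupp.degree_eq_zero_iff d).mp (Nat.lt_one_iff.mp hd)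
  rw [coeff_zero_eq_constantCoeff_apply, coeff_zero_eq_constantCoeff_apply, hf, hg]

theorem constantCoeff {n : ℕ} {f g : MvPowerSeries τ R} (h : AgreeBelow (n + 1) f g) :
    MvPowerSeries.constantCoeff f = MvPowerSeries.constantCoeff g := by
  rw [← coeff_zero_eq_constantCoeff_apply, ← coeff_zero_eq_constantCoeff_apply]
  exact h 0 (by simp)

theorem eq {f g : MvPowerSeries τ R} (h : ∀ n, AgreeBelow n f g) : f = g :=
  MvPowerSeries.ext fun d => h (d.degree + 1) d (Nat.lt_succ_self _)

/-- In `f^q - g^q = (f - g) ∑ f^i g^{q-1-i}` the second factor has no constant term because `q ≥ 2`.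
This is the gain of one degree on which every induction on the degree rests. -/
theorem pow_succ {n q : ℕ} (hq : 2 ≤ q) {f g : MvPowerSeries τ R}
    (hf : MvPowerSeries.constantCoeff f = 0) (hg : MvPowerSeries.constantCoeff g = 0)
    (h : AgreeBelow n f g) : AgreeBelow (n + 1) (f ^ q) (g ^ q) := by
  rw [agreeBelow_iff_le_order] at h ⊢
  rw [← (Commute.all f g).mul_geom_sum₂]
  refine le_trans ?_ le_order_mul
  rw [Nat.cast_add, Nat.cast_one]
  refine add_le_add h (one_le_order_iff_constCoeff_eq_zero.mpr ?_)
  rw [map_sum]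
  refine Finset.sum_eq_zero fun i hi => ?_
  rw [map_mul, map_pow, map_pow, hf, hg, ← pow_add]
  exact zero_pow (by have := Finset.mem_range.mp hi; omega)

theorem pow_zero {q : ℕ} {f : MvPowerSeries τ R} (hf : MvPowerSeries.constantCoeff f = 0) :
    AgreeBelow q (f ^ q) 0 := by
  rw [agreeBelow_iff_le_order, sub_zero]
  exact le_order_pow_of_constantCoeff_eq_zero q hf

theorem truncTotal_eq [Finite τ] {n : ℕ} {f g : MvPowerSeries τ R} (h : AgreeBelow n f g) :
    f.truncTotal n = g.truncTotal n := by
  ext d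
  rw [coeff_truncTotal_eq_ite, coeff_truncTotal_eq_ite]
  split_ifs with hd
  exacts [h d hd, rfl]

theorem of_truncTotal_eq [Finite τ] {n : ℕ} {f g : MvPowerSeries τ R}
    (h : f.truncTotal n = g.truncTotal n) : AgreeBelow n f g := by
  intro d hd
  rw [← coeff_truncTotal f hd, h, coeff_truncTotal g hd]

/-- When the constant terms vanish, the truncation of a composite depends only on the truncations of
the series substituted. -/
theorem subst [Finite σ] [Finite τ] {n : ℕ} (f : MvPowerSeries σ R) {a b : σ → MvPowerSeries τ R}
    (ha : NoConst a) (hb : NoConst b) (h : ∀ i, AgreeBelow n (a i) (b i)) :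
    AgreeBelow n (f.subst a) (f.subst b) := by
  apply of_truncTotal_eq
  rw [truncTotal_subst ha, truncTotal_subst hb]
  simp_rw [fun i => (h i).truncTotal_eq]

end AgreeBelow

/-- A map on tuples of power series without constant terms which increases the degree of agreement
has a fixed point. -/
theorem exists_fixedPoint (T : (ι → MvPowerSeries τ R) → ι → MvPowerSeries τ R)
    (h0 : ∀ a, NoConst a → NoConst (T a))
    (hT : ∀ n a b, NoConst a → NoConst b → (∀ i, AgreeBelow n (a i) (b i)) →
      ∀ i, AgreeBelow (n + 1) (T a i) (T b i)) :
    ∃ a, NoConst a ∧ T a = a := by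
  let s : ℕ → ι → MvPowerSeries τ R := fun k => T^[k] 0
  have hs : ∀ k, s (k + 1) = T (s k) := fun k => Function.iterate_succ_apply' T k 0
  have hs0 : ∀ k, NoConst (s k) := by
    intro k
    induction k with
    | zero => exact NoConst.zero
    | succ k ih =>
      rw [hs]
      exact h0 _ ih
  have hs1 : ∀ k i, AgreeBelow k (s k i) (s (k + 1) i) := by
    intro k
    induction k with
    | zero => exact fun i d hd => absurd hd (Nat.not_lt_zero _)
    | succ k ih =>
      rw [hs k, hs (k + 1)]
      exact hT k _ _ (hs0 k) (hs0 (k + 1)) ih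
  have hs2 : ∀ k l, k ≤ l → ∀ i, AgreeBelow k (s k i) (s l i) := by
    intro k l hkl i
    induction l, hkl using Nat.le_induction with
    | base => exact AgreeBelow.refl _ _
    | succ l hl ih => exact ih.trans ((hs1 l i).mono hl)
  -- The iterates stabilise in each degree: `s k` is already correct in degrees below `k`, so degree
  -- `d` is read off from iterate `d + 1`.
  let a : ι → MvPowerSeries τ R := fun i d => coeff d (s (d.degree + 1) i)
  have ha : ∀ k i, AgreeBelow k (a i) (s k i) := by
    intro k i d hd
    exact hs2 (d.degree + 1) k hd i d (Nat.lt_succ_self _)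
  have ha0 : NoConst a := by
    intro i
    rw [AgreeBelow.constantCoeff (ha 1 i), hs0 1 i]
  refine ⟨a, ha0, funext fun i => AgreeBelow.eq fun n => ?_⟩
  refine AgreeBelow.mono (Nat.le_succ n) ?_
  have h1 := hT n a (s n) ha0 (hs0 n) (ha n) i
  rw [← hs] at h1
  exact h1.trans (ha (n + 1) i).symm

end General

/-! ### Logarithms given by a twisted functional equation -/

/-- `L` has no constant terms and satisfies
`L_a(X) = X_a + p⁻¹ L_{π(a)}(X ^ (p ^ h(a)))` with all `h(a)` positive. -/
structure IsTwistedLog {σ : Type*} (p : ℕ) [Fact p.Prime] (π : σ → σ) (h : σ → ℕ)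
    (L : σ → MvPowerSeries σ ℚ_[p]) : Prop where
  pos : ∀ a, 0 < h a
  noConst : NoConst L
  eq : ∀ a, L a = X a + (p : ℚ_[p])⁻¹ • (L (π a)).subst (fun j => X j ^ p ^ h a :
    σ → MvPowerSeries σ ℚ_[p])

theorem two_le_prime_pow (p : ℕ) [hp : Fact p.Prime] {k : ℕ} (hk : 0 < k) : 2 ≤ p ^ k :=
  hp.out.two_le.trans (Nat.le_self_pow hk.ne' p)

namespace IsTwistedLog

variable {σ τ : Type*} [Finite σ] {p : ℕ} [Fact p.Prime] {π : σ → σ} {h : σ → ℕ}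
  {L : σ → MvPowerSeries σ ℚ_[p]}

omit [Finite σ] in
theorem pow_ne_zero (hL : IsTwistedLog p π h L) (a : σ) : p ^ h a ≠ 0 := by
  have := two_le_prime_pow p (hL.pos a)
  omega

theorem subst_eq (hL : IsTwistedLog p π h L) {G : σ → MvPowerSeries τ ℚ_[p]} (hG : NoConst G)
    (a : σ) : (L a).subst G = G a + (p : ℚ_[p])⁻¹ • (L (π a)).subst (fun j => G j ^ p ^ h a) := by
  have hX : HasSubst (fun j => X j ^ p ^ h a : σ → MvPowerSeries σ ℚ_[p]) :=
    (NoConst.X.pow (hL.pow_ne_zero a)).hasSubst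
  conv_lhs => rw [hL.eq a]
  rw [subst_add hG.hasSubst, subst_smul hG.hasSubst, subst_X hG.hasSubst,
    subst_comp_subst_apply hX hG.hasSubst]
  simp_rw [subst_pow hG.hasSubst, subst_X hG.hasSubst]

variable [Finite τ]

/-- The contraction property: it makes `L(G) = V` solvable recursively in the degree. -/
theorem agreeBelow_succ {n q : ℕ} (hq : 2 ≤ q) {G H : σ → MvPowerSeries τ ℚ_[p]}
    (hG : NoConst G) (hH : NoConst H) (hGH : ∀ i, AgreeBelow n (G i) (H i))
    (f : MvPowerSeries σ ℚ_[p]) :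
    AgreeBelow (n + 1) (f.subst fun j => G j ^ q) (f.subst fun j => H j ^ q) :=
  AgreeBelow.subst _ (hG.pow (by omega)) (hH.pow (by omega)) fun i =>
    AgreeBelow.pow_succ hq (hG i) (hH i) (hGH i)

/-- Solving the functional equation for `G_i` expresses it by `L(G)_i` and `L_{π(i)}(G^{p^{h(i)}})`,
and the latter sees only lower degrees of `G`. -/
theorem comp_injective (hL : IsTwistedLog p π h L) {G H : σ → MvPowerSeries τ ℚ_[p]}
    (hG : NoConst G) (hH : NoConst H) (hGH : comp L G = comp L H) : G = H := by
  have key : ∀ n i, AgreeBelow n (G i) (H i) := by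
    intro n
    induction n with
    | zero => exact fun i d hd => absurd hd (Nat.not_lt_zero _)
    | succ n ih =>
      intro i
      have e := congrFun hGH i
      rw [comp, comp, hL.subst_eq hG, hL.subst_eq hH] at e
      rw [eq_sub_of_add_eq e, ← add_sub]
      nth_rewrite 2 [← add_zero (H i)]
      refine (AgreeBelow.refl _ _).add ?_
      rw [← sub_self ((p : ℚ_[p])⁻¹ • (L (π i)).subst (fun j => G j ^ p ^ h i))]
      refine AgreeBelow.sub (AgreeBelow.smul _ ?_) (AgreeBelow.refl _ _)
      exact (agreeBelow_succ (two_le_prime_pow p (hL.pos i)) hG hH ih _).symm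
  exact funext fun i => AgreeBelow.eq fun n => key n i

theorem exists_comp_eq (hL : IsTwistedLog p π h L) {V : σ → MvPowerSeries τ ℚ_[p]}
    (hV : NoConst V) : ∃ G, NoConst G ∧ comp L G = V := by
  obtain ⟨G, hG, hT⟩ := exists_fixedPoint
    (fun (G : σ → MvPowerSeries τ ℚ_[p]) a =>
      V a - (p : ℚ_[p])⁻¹ • (L (π a)).subst (fun j => G j ^ p ^ h a))
    (fun G hG a => by
      have h1 := (hL.noConst.comp (hG.pow (hL.pow_ne_zero a))) (π a)
      rw [comp] at h1
      simp [hV a, h1])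
    (fun n G H hG hH hGH a => (AgreeBelow.refl _ _).sub
      ((agreeBelow_succ (two_le_prime_pow p (hL.pos a)) hG hH hGH _).smul _))
  refine ⟨G, hG, funext fun a => ?_⟩
  rw [comp, hL.subst_eq hG]
  nth_rewrite 1 [← hT]
  exact sub_add_cancel _ _

/-- The linear terms of `L(G)` are those of `G`. -/
theorem agreeBelow_two (hL : IsTwistedLog p π h L) {G : σ → MvPowerSeries τ ℚ_[p]}
    (hG : NoConst G) (a : σ) : AgreeBelow 2 (comp L G a) (G a) := by
  rw [comp, hL.subst_eq hG]
  nth_rewrite 2 [← add_zero (G a)]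
  refine (AgreeBelow.refl _ _).add ?_
  rw [← smul_zero (p : ℚ_[p])⁻¹]
  refine AgreeBelow.smul _ ?_
  have h1 := agreeBelow_succ (two_le_prime_pow p (hL.pos a)) hG NoConst.zero
    (fun i => AgreeBelow.one (hG i) (NoConst.zero i)) (L (π a))
  have h2 := congrFun (comp_zero hL.noConst (τ := τ)) (π a)
  simp only [Pi.zero_apply, zero_pow (hL.pow_ne_zero a)] at h1
  rw [comp] at h2
  change AgreeBelow 2 _ (subst (0 : σ → MvPowerSeries τ ℚ_[p]) (L (π a))) at h1
  rwa [h2] at h1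

end IsTwistedLog

/-- A right inverse `M` solves `L(M) = X`. It is also a left inverse because `L(M(L)) = L = L(X)`
and `L` can be cancelled. -/
theorem IsTwistedLog.exists_isCompInverse {n p : ℕ} [Fact p.Prime] {π : Fin n → Fin n}
    {h : Fin n → ℕ} {L : Fin n → MvPowerSeries (Fin n) ℚ_[p]} (hL : IsTwistedLog p π h L) :
    ∃ M, IsCompInverse L M := by
  obtain ⟨M, hM, hLM⟩ := hL.exists_comp_eq NoConst.X
  refine ⟨M, hM, hLM, hL.comp_injective (hM.comp hL.noConst) NoConst.X ?_⟩
  rw [← comp_comp hM.hasSubst hL.noConst.hasSubst, hLM, X_comp hL.noConst.hasSubst, comp_X]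

theorem isCompInverse_compInverse {n : ℕ} {K : Type*} [CommRing K]
    {L : Fin n → MvPowerSeries (Fin n) K} (h : ∃ M, IsCompInverse L M) :
    IsCompInverse L (compInverse L) := by
  rw [compInverse, dif_pos h]
  exact h.choose_spec

/-! ### Divisibility by powers of `p` -/

section Divisibility

variable {σ τ R : Type*} [CommRing R]

theorem natCast_dvd_iff {r : ℕ} {f : MvPowerSeries τ R} :
    (r : MvPowerSeries τ R) ∣ f ↔ ∀ d, (r : R) ∣ coeff d f := by
  constructor
  · rintro ⟨g, rfl⟩ d
    rw [← map_natCast (C : R →+* MvPowerSeries τ R), coeff_C_mul]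
    exact dvd_mul_right _ _
  · intro h
    choose g hg using h
    let g' : MvPowerSeries τ R := g
    refine ⟨g', MvPowerSeries.ext fun d => ?_⟩
    rw [← map_natCast (C : R →+* MvPowerSeries τ R), coeff_C_mul, hg]
    rfl

/-- Expansion moves degree `m` to `q m`, which exceeds `m` unless `m = 0`; the constant terms agree
by hypothesis. -/
theorem AgreeBelow.expand_succ {q : ℕ} (hq : 2 ≤ q) (hq0 : q ≠ 0) {n : ℕ} {f g : MvPowerSeries τ R}
    (hf : MvPowerSeries.constantCoeff f = 0) (hg : MvPowerSeries.constantCoeff g = 0)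
    (h : AgreeBelow n f g) :
    AgreeBelow (n + 1) (expand q hq0 f) (expand q hq0 g) := by
  intro d hd
  by_cases hdvd : ∀ j, q ∣ d j
  · obtain ⟨m, rfl⟩ : ∃ m : τ →₀ ℕ, d = q • m := by
      refine ⟨d.mapRange (fun a => a / q) (Nat.zero_div q), ?_⟩
      ext j
      simp [Nat.mul_div_cancel' (hdvd j)]
    rw [coeff_expand_smul, coeff_expand_smul]
    rcases Nat.eq_zero_or_pos m.degree with hm | hm
    · exact AgreeBelow.one hf hg m (by omega)
    · apply h
      rw [map_nsmul, smul_eq_mul] at hd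
      nlinarith
  · push Not at hdvd
    obtain ⟨j, hj⟩ := hdvd
    rw [coeff_expand_of_not_dvd q hq0 f hj, coeff_expand_of_not_dvd q hq0 g hj]

variable {p : ℕ} [hp : Fact p.Prime]

/-- `f ^ (p ^ k) ≡ f(X ^ (p ^ k))` modulo `p` for power series `f` over `ℤ_p`. -/
theorem prime_dvd_pow_sub_expand (f : MvPowerSeries τ ℤ_[p]) (k : ℕ) (hk : p ^ k ≠ 0) :
    (p : MvPowerSeries τ ℤ_[p]) ∣ f ^ p ^ k - expand (p ^ k) hk f := by
  have key : map (PadicInt.toZMod (p := p)) (f ^ p ^ k - expand (p ^ k) hk f) = 0 := by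
    -- Over `𝔽_p` the Frobenius fixes all coefficients, so raising to the power `p^k` only expands
    -- the variables.
    rw [map_sub, map_pow, map_expand, ← map_iterateFrobenius_expand p hp.out.ne_zero, sub_eq_zero]
    ext d
    rw [coeff_map, iterateFrobenius_def, ZMod.pow_card_pow]
  rw [natCast_dvd_iff]
  intro d
  rw [← Ideal.mem_span_singleton, ← PadicInt.maximalIdeal_eq_span_p, ← PadicInt.ker_toZMod,
    RingHom.mem_ker, ← coeff_map, key, map_zero]

/-- The subgroup `p ^ k ℤ_p` of `ℚ_p`. -/
def primePowMul (p : ℕ) [Fact p.Prime] (k : ℕ) : AddSubgroup ℚ_[p] where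
  carrier := {x | ∃ c : ℤ_[p], x = (p : ℚ_[p]) ^ k * c}
  add_mem' := by
    rintro _ _ ⟨a, rfl⟩ ⟨b, rfl⟩
    exact ⟨a + b, by push_cast; ring⟩
  zero_mem' := ⟨0, by simp⟩
  neg_mem' := by
    rintro _ ⟨a, rfl⟩
    exact ⟨-a, by push_cast; ring⟩

theorem primePowMul_anti {k l : ℕ} (hkl : k ≤ l) : primePowMul p l ≤ primePowMul p k := by
  rintro _ ⟨c, rfl⟩
  refine ⟨(p : ℤ_[p]) ^ (l - k) * c, ?_⟩
  push_cast
  rw [← mul_assoc, ← pow_add, Nat.add_sub_cancel' hkl]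

theorem inv_mul_mem_primePowMul {k : ℕ} {x : ℚ_[p]} (hx : x ∈ primePowMul p (k + 1)) :
    (p : ℚ_[p])⁻¹ * x ∈ primePowMul p k := by
  obtain ⟨c, rfl⟩ := hx
  have hp0 : (p : ℚ_[p]) ≠ 0 := Nat.cast_ne_zero.mpr hp.out.ne_zero
  exact ⟨c, by rw [pow_succ]; field_simp⟩

theorem coe_mem_primePowMul {k : ℕ} {c : ℤ_[p]} (h : (p : ℤ_[p]) ^ k ∣ c) :
    (c : ℚ_[p]) ∈ primePowMul p k := by
  obtain ⟨b, rfl⟩ := h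
  exact ⟨b, by push_cast; rfl⟩

theorem dvd_of_coe_mem_primePowMul {k : ℕ} {c : ℤ_[p]} (h : (c : ℚ_[p]) ∈ primePowMul p k) :
    (p : ℤ_[p]) ^ k ∣ c := by
  obtain ⟨b, hb⟩ := h
  exact ⟨b, PadicInt.ext (by rw [hb]; push_cast; rfl)⟩

theorem coeff_map_mem_primePowMul {k : ℕ} {f : MvPowerSeries τ ℤ_[p]}
    (h : (p : MvPowerSeries τ ℤ_[p]) ^ k ∣ f) (d : τ →₀ ℕ) :
    coeff d (map PadicInt.Coe.ringHom f) ∈ primePowMul p k := by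
  rw [coeff_map]
  refine coe_mem_primePowMul ?_
  rw [← Nat.cast_pow] at h ⊢
  exact natCast_dvd_iff.mp h d

theorem coe_padicInt_injective : Function.Injective (PadicInt.Coe.ringHom (p := p)) :=
  Subtype.coe_injective

/-- Low-degree coefficients in `p ^ k ℤ_p` can be lifted to a polynomial over `ℤ_p`. -/
theorem exists_lift_below {k n : ℕ} {ι : Type*} {G : ι → MvPowerSeries τ ℚ_[p]}
    (hG : ∀ i (d : τ →₀ ℕ), d.degree < n → coeff d (G i) ∈ primePowMul p k) :
    ∃ D : ι → MvPowerSeries τ ℤ_[p], ∀ i d,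
      (p : ℚ_[p]) ^ k * coeff d (D i) = if d.degree < n then coeff d (G i) else 0 := by
  have h : ∀ i (d : τ →₀ ℕ), ∃ c : ℤ_[p],
      (p : ℚ_[p]) ^ k * c = if d.degree < n then coeff d (G i) else 0 := by
    intro i d
    split_ifs with hd
    · obtain ⟨c, hc⟩ := hG i d hd
      exact ⟨c, hc.symm⟩
    · exact ⟨0, by simp⟩
  choose D hD using h
  exact ⟨D, hD⟩

end Divisibility

/-! ### Congruences and integrality: the functional equation lemma -/

namespace IsTwistedLog

variable {σ τ : Type*} [Finite σ] [Finite τ] {p : ℕ} [hp : Fact p.Prime] {π : σ → σ} {h : σ → ℕ}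
  {L : σ → MvPowerSeries σ ℚ_[p]}

/-- The factor `p⁻¹` in the functional equation costs one power of `p`, while the exponent grows
from `k` to `k + h(a)`, which gains `h(a) ≥ 1` powers. The bound `n + k` on the degree makes this a
terminating induction on `n`: since `n + 1 + k ≤ n + (k + h(a))`, the new term falls under the
hypothesis for `n`. -/
theorem coeff_subst_pow_sub_mem_of_lt (hL : IsTwistedLog p π h L) {G H : σ → MvPowerSeries τ ℤ_[p]}
    (hG : NoConst G) (hH : NoConst H) (hGH : ∀ i, (p : MvPowerSeries τ ℤ_[p]) ∣ G i - H i) (n : ℕ) :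
    ∀ k a (d : τ →₀ ℕ), d.degree < n + k →
      coeff d ((L a).subst (fun j => mapCoeff PadicInt.Coe.ringHom G j ^ p ^ k) -
        (L a).subst (fun j => mapCoeff PadicInt.Coe.ringHom H j ^ p ^ k)) ∈
          primePowMul p (k + 1) := by
  have hpk : ∀ k, p ^ k ≠ 0 := fun k => (pow_pos hp.out.pos k).ne'
  induction n with
  | zero =>
    intro k a d hd
    have hz : ∀ G : σ → MvPowerSeries τ ℤ_[p], NoConst G → coeff d
        ((L a).subst (fun j => mapCoeff PadicInt.Coe.ringHom G j ^ p ^ k)) = 0 := by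
      intro G hG
      have hG' : NoConst (mapCoeff (PadicInt.Coe.ringHom (p := p)) G) := hG.map _
      -- A `p^k`-th power has no terms of degree below `p^k`, and `p^k > k`; so in degrees below `k`
      -- both composites vanish.
      have h1 := AgreeBelow.subst (n := k) (L a) (hG'.pow (hpk k)) NoConst.zero
        (fun i => (AgreeBelow.pow_zero (hG' i)).mono (Nat.lt_pow_self hp.out.one_lt).le)
      have h2 := congrFun (comp_zero hL.noConst (τ := τ)) a
      rw [comp] at h2
      rw [h1 d (by omega), h2]
      simp
    rw [map_sub, hz G hG, hz H hH, sub_zero]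
    exact zero_mem _
  | succ n ih =>
    intro k a d hd
    have hG' : NoConst (mapCoeff (PadicInt.Coe.ringHom (p := p)) G) := hG.map _
    have hH' : NoConst (mapCoeff (PadicInt.Coe.ringHom (p := p)) H) := hH.map _
    rw [hL.subst_eq (hG'.pow (hpk k)), hL.subst_eq (hH'.pow (hpk k)), add_sub_add_comm, map_add]
    refine add_mem ?_ ?_
    · have h1 := coeff_map_mem_primePowMul (dvd_sub_pow_of_dvd_sub (hGH a) k) d
      rw [map_sub, map_pow, map_pow] at h1
      exact h1
    · simp_rw [← pow_mul, ← pow_add]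
      rw [← smul_sub, coeff_smul]
      have ha := hL.pos a
      exact inv_mul_mem_primePowMul (primePowMul_anti (by omega)
        (ih (k + h a) (π a) d (by omega)))

/-- If `G ≡ H` modulo `p`, then `L(G ^ (p ^ k)) ≡ L(H ^ (p ^ k))` modulo `p ^ (k + 1)`. -/
theorem coeff_subst_pow_sub_mem (hL : IsTwistedLog p π h L) {G H : σ → MvPowerSeries τ ℤ_[p]}
    (hG : NoConst G) (hH : NoConst H) (hGH : ∀ i, (p : MvPowerSeries τ ℤ_[p]) ∣ G i - H i)
    (k : ℕ) (a : σ) (d : τ →₀ ℕ) :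
    coeff d ((L a).subst (fun j => mapCoeff PadicInt.Coe.ringHom G j ^ p ^ k) -
      (L a).subst (fun j => mapCoeff PadicInt.Coe.ringHom H j ^ p ^ k)) ∈
        primePowMul p (k + 1) :=
  hL.coeff_subst_pow_sub_mem_of_lt hG hH hGH (d.degree + 1) k a d (by omega)

/-- `L(G ^ (p ^ k)) ≡ L(G)(X ^ (p ^ k))` modulo `p` for integral `G`. -/
theorem coeff_subst_pow_sub_expand_mem (hL : IsTwistedLog p π h L)
    {G : σ → MvPowerSeries τ ℤ_[p]} (hG : NoConst G) (k : ℕ) (hk : p ^ k ≠ 0) (a : σ)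
    (d : τ →₀ ℕ) :
    coeff d ((L a).subst (fun j => mapCoeff PadicInt.Coe.ringHom G j ^ p ^ k) -
      expand (p ^ k) hk (comp L (mapCoeff PadicInt.Coe.ringHom G) a)) ∈ primePowMul p 1 := by
  have hE : NoConst (fun i => expand (p ^ k) hk (G i)) := fun i => by
    rw [constantCoeff_expand, hG i]
  have h1 := hL.coeff_subst_pow_sub_mem (hG.pow hk) hE
    (fun i => prime_dvd_pow_sub_expand (G i) k hk) 0 a d
  rw [comp, expand_subst _ _ (hG.map _).hasSubst]
  simpa [mapCoeff] using h1

/-- The functional equation lemma: `V = L(G)` for an integral `G` as soon as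
`V_a(X) - p⁻¹ V_{π(a)}(X ^ (p ^ h(a)))` is integral for all `a`. -/
theorem exists_integral (hL : IsTwistedLog p π h L) {V : σ → MvPowerSeries τ ℚ_[p]}
    (hV : NoConst V)
    (hint : ∀ a d, coeff d (V a - (p : ℚ_[p])⁻¹ • expand (p ^ h a) (hL.pow_ne_zero a) (V (π a))) ∈
      primePowMul p 0) :
    ∃ G : σ → MvPowerSeries τ ℤ_[p], NoConst G ∧
      comp L (mapCoeff PadicInt.Coe.ringHom G) = V := by
  obtain ⟨G, hG, rfl⟩ := hL.exists_comp_eq hV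
  have key : ∀ n i (d : τ →₀ ℕ), d.degree < n → coeff d (G i) ∈ primePowMul p 0 := by
    intro n
    induction n with
    | zero => exact fun i d hd => absurd hd (Nat.not_lt_zero _)
    | succ n ih =>
      intro a d hd
      -- `D` is the truncation of `G`, integral by induction. It may replace `G` in the two terms
      -- with `p⁻¹`, since these see only lower degrees of `G`.
      obtain ⟨D, hD⟩ := exists_lift_below ih
      simp only [pow_zero, one_mul] at hD
      have hD0 : NoConst D := by
        intro i
        have h1 := hD i 0
        rw [coeff_zero_eq_constantCoeff_apply, coeff_zero_eq_constantCoeff_apply, hG i,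
          ite_self] at h1
        exact Subtype.coe_injective h1
      have hD0' : NoConst (mapCoeff (PadicInt.Coe.ringHom (p := p)) D) := hD0.map _
      have hDG : ∀ i, AgreeBelow n (G i) (mapCoeff PadicInt.Coe.ringHom D i) := by
        intro i e he
        have h1 := hD i e
        rw [if_pos he] at h1
        rw [← h1, mapCoeff, coeff_map]
        rfl
      have hq := two_le_prime_pow p (hL.pos a)
      have h1 := agreeBelow_succ hq hG hD0' hDG (L (π a)) d hd
      have h2 := AgreeBelow.expand_succ hq (hL.pow_ne_zero a) ((hL.noConst.comp hG) (π a))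
        ((hL.noConst.comp hD0') (π a)) (AgreeBelow.subst (L (π a)) hG hD0' hDG) d hd
      have h3 := hint a d
      have h4 := inv_mul_mem_primePowMul
        (hL.coeff_subst_pow_sub_expand_mem hD0 (h a) (hL.pow_ne_zero a) (π a) d)
      have h5 : comp L G a = _ := hL.subst_eq hG a
      rw [h5, map_sub, map_add, coeff_smul, coeff_smul, h1, h2] at h3
      rw [map_sub, mul_sub] at h4
      -- The two terms with denominator `p` cancel, leaving the coefficient of `G a` alone.
      have h6 := sub_mem h3 h4
      ring_nf at h6
      exact h6
  obtain ⟨D, hD⟩ : ∃ D : σ → MvPowerSeries τ ℤ_[p], mapCoeff PadicInt.Coe.ringHom D = G := by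
    have h1 : ∀ i (d : τ →₀ ℕ), ∃ c : ℤ_[p], coeff d (G i) = c := by
      intro i d
      obtain ⟨c, hc⟩ := key (d.degree + 1) i d (Nat.lt_succ_self _)
      exact ⟨c, by rw [hc, pow_zero, one_mul]⟩
    choose D hD using h1
    refine ⟨D, funext fun i => MvPowerSeries.ext fun d => ?_⟩
    exact (coeff_map _ d _).trans (hD i d).symm
  subst hD
  exact ⟨D, hG.of_map coe_padicInt_injective, rfl⟩

/-- If `L(G) ≡ L(H)` modulo `p` for integral `G` and `H`, then `G ≡ H` modulo `p`. -/
theorem dvd_sub_of_comp_sub_mem (hL : IsTwistedLog p π h L) {G H : σ → MvPowerSeries τ ℤ_[p]}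
    (hG : NoConst G) (hH : NoConst H)
    (hGH : ∀ a d, coeff d (comp L (mapCoeff PadicInt.Coe.ringHom G) a -
      comp L (mapCoeff PadicInt.Coe.ringHom H) a) ∈ primePowMul p 1) (a : σ) :
    (p : MvPowerSeries τ ℤ_[p]) ∣ G a - H a := by
  have hG' : NoConst (mapCoeff (PadicInt.Coe.ringHom (p := p)) G) := hG.map _
  have hH' : NoConst (mapCoeff (PadicInt.Coe.ringHom (p := p)) H) := hH.map _
  have key : ∀ n i (d : τ →₀ ℕ), d.degree < n →
      coeff d (map (PadicInt.Coe.ringHom (p := p)) (G i - H i)) ∈ primePowMul p 1 := by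
    intro n
    induction n with
    | zero => exact fun i d hd => absurd hd (Nat.not_lt_zero _)
    | succ n ih =>
      intro a d hd
      obtain ⟨D, hD⟩ := exists_lift_below
        (G := fun i => map (PadicInt.Coe.ringHom (p := p)) (G i - H i)) ih
      have hp0 : (p : ℚ_[p]) ≠ 0 := Nat.cast_ne_zero.mpr hp.out.ne_zero
      have hD0 : NoConst D := by
        intro i
        have h1 := hD i 0
        rw [coeff_zero_eq_constantCoeff_apply, coeff_zero_eq_constantCoeff_apply, map_sub, map_sub,
          constantCoeff_map, constantCoeff_map, hG i, hH i, sub_self, ite_self, pow_one] at h1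
        exact Subtype.coe_injective ((mul_eq_zero.mp h1).resolve_left hp0)
      -- `K` agrees with `G` in degrees below `n` and is congruent to `H` modulo `p` in all degrees.
      -- It thus replaces `G` in the next degree and admits the comparison of `L(K^{p^{h(a)}})` with
      -- `L(H^{p^{h(a)}})`.
      let K : σ → MvPowerSeries τ ℤ_[p] := fun i => H i + (p : MvPowerSeries τ ℤ_[p]) * D i
      have hK : NoConst K := fun i => by simp [K, hH i, hD0 i]
      have hK' : NoConst (mapCoeff (PadicInt.Coe.ringHom (p := p)) K) := hK.map _
      have hGK : ∀ i, AgreeBelow n (mapCoeff PadicInt.Coe.ringHom G i)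
          (mapCoeff PadicInt.Coe.ringHom K i) := by
        intro i e he
        have h1 := hD i e
        rw [if_pos he, map_sub, map_sub, pow_one] at h1
        rw [mapCoeff, mapCoeff, eq_add_of_sub_eq h1.symm, map_add, map_add, map_mul, map_natCast,
          ← map_natCast (C : ℚ_[p] →+* MvPowerSeries τ ℚ_[p]), coeff_C_mul, coeff_map _ e (D i),
          add_comm]
        rfl
      have h1 := agreeBelow_succ (two_le_prime_pow p (hL.pos a)) hG' hK' hGK (L (π a)) d hd
      have h2 := hL.coeff_subst_pow_sub_mem hK hH
        (fun i => ⟨D i, by simp [K]⟩) (h a) (π a) d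
      -- That comparison holds modulo `p^{h(a)+1}`, hence modulo `p²`; dividing by `p` leaves a
      -- congruence modulo `p`.
      have h3 := inv_mul_mem_primePowMul (primePowMul_anti
        (show 1 + 1 ≤ h a + 1 by have := hL.pos a; omega) h2)
      have h4 := hGH a d
      have h5 : comp L (mapCoeff PadicInt.Coe.ringHom G) a = _ := hL.subst_eq hG' a
      have h6 : comp L (mapCoeff PadicInt.Coe.ringHom H) a = _ := hL.subst_eq hH' a
      rw [h5, h6, map_sub, map_add, map_add, coeff_smul, coeff_smul, h1] at h4
      rw [map_sub, mul_sub] at h3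
      have h7 := sub_mem h4 h3
      rw [map_sub, map_sub]
      ring_nf at h7
      exact h7
  rw [natCast_dvd_iff]
  intro d
  have h1 := key (d.degree + 1) a d (Nat.lt_succ_self _)
  rw [coeff_map] at h1
  simpa using dvd_of_coe_mem_primePowMul h1

/-- `p L(X) = p X + L(φ(X))` for `φ(X)_a = X_{π(a)} ^ (p ^ h(a))`. -/
theorem comp_twist (hL : IsTwistedLog p π h L) (a : σ) :
    comp L (fun a => X (π a) ^ p ^ h a : σ → MvPowerSeries σ ℚ_[p]) a + (p : ℚ_[p]) • X a =
      (p : ℚ_[p]) • L a := by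
  have hp0 : (p : ℚ_[p]) ≠ 0 := Nat.cast_ne_zero.mpr hp.out.ne_zero
  have hφ : NoConst (fun a => X (π a) ^ p ^ h a : σ → MvPowerSeries σ ℚ_[p]) :=
    fun a => by rw [map_pow, constantCoeff_X, zero_pow (hL.pow_ne_zero a)]
  have hexp : ∀ a, L a = X a + (p : ℚ_[p])⁻¹ • expand (p ^ h a) (hL.pow_ne_zero a) (L (π a)) := by
    intro a
    rw [expand, substAlgHom_apply]
    exact hL.eq a
  -- Both families `W` satisfy `W_a = X_{π(a)}^{q_a} + p⁻¹ W_{π(a)}(X^{q_a})`, where `q_a =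
  -- p^{h(a)}`: for `L(φ)` because `φ(X)^{q_a} = φ(X^{q_a})`, for the other by expanding `L_{π(a)}`
  -- once more. Such a recursion has only one solution without constant term.
  have key : ∀ n a, AgreeBelow n
      (comp L (fun a => X (π a) ^ p ^ h a : σ → MvPowerSeries σ ℚ_[p]) a)
      (expand (p ^ h a) (hL.pow_ne_zero a) (L (π a))) := by
    intro n
    induction n with
    | zero => exact fun i d hd => absurd hd (Nat.not_lt_zero _)
    | succ n ih =>
      intro a
      have e1 : (L (π a)).subst (fun j => (X (π j) ^ p ^ h j) ^ p ^ h a) =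
          expand (p ^ h a) (hL.pow_ne_zero a)
            (comp L (fun a => X (π a) ^ p ^ h a : σ → MvPowerSeries σ ℚ_[p]) (π a)) := by
        rw [comp, expand_subst _ _ hφ.hasSubst]
        simp_rw [map_pow, expand_X, pow_right_comm]
      rw [comp, hL.subst_eq hφ, e1, hexp (π a), map_add, map_smul, expand_X]
      refine (AgreeBelow.refl _ _).add (AgreeBelow.smul _ ?_)
      exact AgreeBelow.expand_succ (two_le_prime_pow p (hL.pos a)) _ ((hL.noConst.comp hφ) (π a))
        (by rw [constantCoeff_expand, hL.noConst]) (ih (π a))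
  rw [AgreeBelow.eq fun n => key n a]
  conv_rhs => rw [hexp a]
  rw [smul_add, smul_inv_smul₀ hp0, add_comm]

end IsTwistedLog

/-! ### The formal group with logarithm `L` and its multiplications -/

namespace IsTwistedLog

variable {τ : Type*} [Finite τ] {n p : ℕ} [hp : Fact p.Prime] {π : Fin n → Fin n} {h : Fin n → ℕ}
  {L : Fin n → MvPowerSeries (Fin n) ℚ_[p]} {F : Fin n → MvPowerSeries (Fin n ⊕ Fin n) ℤ_[p]}

theorem integral_ext (hL : IsTwistedLog p π h L) {G H : Fin n → MvPowerSeries τ ℤ_[p]}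
    (hG : NoConst G) (hH : NoConst H)
    (hGH : comp L (mapCoeff PadicInt.Coe.ringHom G) = comp L (mapCoeff PadicInt.Coe.ringHom H)) :
    G = H :=
  mapCoeff_injective coe_padicInt_injective (hL.comp_injective (hG.map _) (hH.map _) hGH)

omit [Finite τ] in
/-- `L(A +_F B) = L(A) + L(B)`. -/
theorem comp_mapCoeff_fadd (hF : NoConst F)
    (hFL : comp L (mapCoeff PadicInt.Coe.ringHom F) =
      comp L (fun i => X (Sum.inl i)) + comp L (fun i => X (Sum.inr i)))
    {A B : Fin n → MvPowerSeries τ ℤ_[p]} (hA : NoConst A) (hB : NoConst B) :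
    comp L (mapCoeff PadicInt.Coe.ringHom (fadd F A B)) =
      comp L (mapCoeff PadicInt.Coe.ringHom A) + comp L (mapCoeff PadicInt.Coe.ringHom B) := by
  have hA' : NoConst (mapCoeff (PadicInt.Coe.ringHom (p := p)) A) := hA.map _
  have hB' : NoConst (mapCoeff (PadicInt.Coe.ringHom (p := p)) B) := hB.map _
  have hAB := (hA'.sumElim hB').hasSubst
  rw [mapCoeff_fadd _ F hA hB, comp_fadd L (hF.map _) hA' hB', hFL, add_comp hAB,
    comp_comp (NoConst.X_apply _).hasSubst hAB, comp_comp (NoConst.X_apply _).hasSubst hAB,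
    comp_sumElim_inl hAB, comp_sumElim_inr hAB]

omit [Finite τ] in
-- This is the integrality defect in `exists_integral`. It is additive in `V`, so the cases `L(X) +
-- L(Y)` and `-L` follow from this one.
theorem comp_X_apply_sub (hL : IsTwistedLog p π h L) (e : Fin n → τ) (a : Fin n) :
    comp L (fun i => X (e i) : Fin n → MvPowerSeries τ ℚ_[p]) a -
      (p : ℚ_[p])⁻¹ • expand (p ^ h a) (hL.pow_ne_zero a) (comp L (fun i => X (e i)) (π a)) =
        X (e a) := by
  have hX : NoConst (fun i => X (e i) : Fin n → MvPowerSeries τ ℚ_[p]) := NoConst.X_apply e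
  simp_rw [comp, expand_subst _ (hL.pow_ne_zero a) hX.hasSubst, hL.subst_eq hX a, expand_X]
  exact add_sub_cancel_right _ _

omit [Finite τ] in
theorem coeff_X_mem (t : τ) (d : τ →₀ ℕ) :
    coeff d (X t : MvPowerSeries τ ℚ_[p]) ∈ primePowMul p 0 := by
  have h1 := coeff_map_mem_primePowMul (p := p) (k := 0) (f := X t) (by simp) d
  rwa [map_X] at h1

/-- The formal group with logarithm `L` is integral. -/
theorem exists_integral_formalGroup (hL : IsTwistedLog p π h L) :
    ∃ F : Fin n → MvPowerSeries (Fin n ⊕ Fin n) ℤ_[p], NoConst F ∧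
      comp L (mapCoeff PadicInt.Coe.ringHom F) =
        comp L (fun i => X (Sum.inl i)) + comp L (fun i => X (Sum.inr i)) := by
  refine hL.exists_integral ((hL.noConst.comp (NoConst.X_apply _)).add
    (hL.noConst.comp (NoConst.X_apply _))) fun a d => ?_
  rw [Pi.add_apply, Pi.add_apply, map_add, smul_add, add_sub_add_comm,
    hL.comp_X_apply_sub Sum.inl, hL.comp_X_apply_sub Sum.inr, map_add]
  exact add_mem (coeff_X_mem _ _) (coeff_X_mem _ _)

/-- Provides the inverse for `F`: the series `ι` with `L(ι) = -L(X)`. -/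
theorem exists_integral_neg (hL : IsTwistedLog p π h L) :
    ∃ ι : Fin n → MvPowerSeries (Fin n) ℤ_[p], NoConst ι ∧
      comp L (mapCoeff PadicInt.Coe.ringHom ι) = -L := by
  refine hL.exists_integral hL.noConst.neg fun a d => ?_
  have h1 := hL.comp_X_apply_sub (τ := Fin n) (fun i => i) a
  have h2 : comp L (fun i => X i) = L := comp_X L
  rw [h2] at h1
  rw [Pi.neg_apply, Pi.neg_apply, map_neg, smul_neg, ← neg_sub', h1, map_neg]
  exact neg_mem (coeff_X_mem _ _)

theorem agreeBelow_two_of_comp_eq (hL : IsTwistedLog p π h L) {G : Fin n → MvPowerSeries τ ℤ_[p]}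
    (hG : NoConst G) {V : Fin n → MvPowerSeries τ ℚ_[p]} {f : MvPowerSeries τ ℤ_[p]} (a : Fin n)
    (hV : comp L (mapCoeff PadicInt.Coe.ringHom G) = V)
    (hf : AgreeBelow 2 (V a) (map PadicInt.Coe.ringHom f)) : AgreeBelow 2 (G a) f := by
  have h1 := hL.agreeBelow_two (hG.map (PadicInt.Coe.ringHom (p := p))) a
  rw [hV] at h1
  intro d hd
  apply coe_padicInt_injective
  have h2 := (h1.symm.trans hf) d hd
  rwa [mapCoeff, coeff_map, coeff_map] at h2

/-- `L` turns `F` into addition and can be cancelled on integral tuples, so each axiom reduces to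
the corresponding law of an additive group. -/
theorem isFormalGroup (hL : IsTwistedLog p π h L) (hF : NoConst F)
    (hFL : comp L (mapCoeff PadicInt.Coe.ringHom F) =
      comp L (fun i => X (Sum.inl i)) + comp L (fun i => X (Sum.inr i))) :
    IsFormalGroup F := by
  have hzero : ∀ τ : Type, comp L (mapCoeff (PadicInt.Coe.ringHom (p := p))
      (0 : Fin n → MvPowerSeries τ ℤ_[p])) = 0 := by
    intro τ
    rw [← comp_zero hL.noConst]
    congr 1
  have hX : NoConst (X : Fin n → MvPowerSeries (Fin n) ℤ_[p]) := NoConst.X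
  have hLX : comp L (mapCoeff PadicInt.Coe.ringHom (X : Fin n → MvPowerSeries (Fin n) ℤ_[p])) =
      L := by rw [mapCoeff_X, comp_X]
  refine ⟨fun i => ?_, ?_, ?_, ?_, ?_⟩
  · refine hL.agreeBelow_two_of_comp_eq hF i hFL ?_
    rw [map_add, map_X, map_X]
    exact (hL.agreeBelow_two (NoConst.X_apply _) i).add (hL.agreeBelow_two (NoConst.X_apply _) i)
  · have hx (e : Fin n → Fin n ⊕ Fin n ⊕ Fin n) :
        NoConst (fun i => X (e i) : Fin n → MvPowerSeries (Fin n ⊕ Fin n ⊕ Fin n) ℤ_[p]) :=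
      NoConst.X_apply e
    have hxy := hF.fadd (hx fun i => Sum.inl i) (hx fun i => Sum.inr (Sum.inl i))
    have hyz := hF.fadd (hx fun i => Sum.inr (Sum.inl i)) (hx fun i => Sum.inr (Sum.inr i))
    refine hL.integral_ext (hF.fadd hxy (hx _)) (hF.fadd (hx _) hyz) ?_
    rw [comp_mapCoeff_fadd hF hFL hxy (hx _), comp_mapCoeff_fadd hF hFL (hx _) (hx _),
      comp_mapCoeff_fadd hF hFL (hx _) hyz, comp_mapCoeff_fadd hF hFL (hx _) (hx _),
      add_assoc]
  · refine hL.integral_ext (hF.fadd hX NoConst.zero) hX ?_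
    rw [comp_mapCoeff_fadd hF hFL hX NoConst.zero, hzero, add_zero]
  · refine hL.integral_ext (hF.fadd NoConst.zero hX) hX ?_
    rw [comp_mapCoeff_fadd hF hFL NoConst.zero hX, hzero, zero_add]
  · obtain ⟨ι, hι, hιL⟩ := hL.exists_integral_neg
    refine ⟨ι, ⟨hι, ?_, ?_⟩, ?_⟩
    · refine hL.integral_ext (hF.fadd hX hι) NoConst.zero ?_
      rw [comp_mapCoeff_fadd hF hFL hX hι, hzero, hLX, hιL, add_neg_cancel]
    · refine hL.integral_ext (hF.fadd hι hX) NoConst.zero ?_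
      rw [comp_mapCoeff_fadd hF hFL hι hX, hzero, hLX, hιL, neg_add_cancel]
    · rintro κ ⟨hκ, hκ', -⟩
      refine hL.integral_ext hκ hι ?_
      have h1 := comp_mapCoeff_fadd hF hFL hX hκ
      rw [hκ', hzero, hLX] at h1
      rw [hιL]
      exact (neg_eq_of_add_eq_zero_right h1.symm).symm

/-- `L([k]_F(X)) = k L(X)`. -/
theorem comp_mapCoeff_mulBy (hL : IsTwistedLog p π h L) (hF : NoConst F)
    (hFL : comp L (mapCoeff PadicInt.Coe.ringHom F) =
      comp L (fun i => X (Sum.inl i)) + comp L (fun i => X (Sum.inr i))) :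
    ∀ k : ℕ, comp L (mapCoeff PadicInt.Coe.ringHom (mulBy F k)) = k • L
  | 0 => by
    rw [zero_smul, ← comp_zero hL.noConst]
    congr 1
  | 1 => by rw [mulBy, mapCoeff_X, comp_X, one_smul]
  | k + 2 => by
    rw [mulBy, comp_mapCoeff_fadd hF hFL NoConst.X (hF.mulBy (k + 1)),
      comp_mapCoeff_mulBy hL hF hFL (k + 1), mapCoeff_X, comp_X, succ_nsmul' L (k + 1)]

/-- After applying `L`, both sides become `k (L(X) + L(Y))`. -/
theorem isEndomorphism_mulBy (hL : IsTwistedLog p π h L) (hF : NoConst F)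
    (hFL : comp L (mapCoeff PadicInt.Coe.ringHom F) =
      comp L (fun i => X (Sum.inl i)) + comp L (fun i => X (Sum.inr i))) (k : ℕ) :
    IsEndomorphism F (mulBy F k) := by
  have hm := hF.mulBy k
  have hx (e : Fin n → Fin n ⊕ Fin n) :
      NoConst (fun i => X (e i) : Fin n → MvPowerSeries (Fin n ⊕ Fin n) ℤ_[p]) :=
    NoConst.X_apply e
  have key : ∀ A : Fin n → MvPowerSeries (Fin n ⊕ Fin n) ℤ_[p], NoConst A →
      comp L (mapCoeff PadicInt.Coe.ringHom (comp (mulBy F k) A)) =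
        k • comp L (mapCoeff PadicInt.Coe.ringHom A) := by
    intro A hA
    rw [mapCoeff_comp _ _ hA.hasSubst, ← comp_comp (hm.map _).hasSubst (hA.map _).hasSubst,
      hL.comp_mapCoeff_mulBy hF hFL, nsmul_comp (hA.map _).hasSubst]
  refine ⟨hm, hL.integral_ext (hm.comp hF) (hF.fadd (hm.comp (hx _)) (hm.comp (hx _))) ?_⟩
  rw [comp_mapCoeff_fadd hF hFL (hm.comp (hx _)) (hm.comp (hx _)), key F hF, key _ (hx _),
    key _ (hx _), hFL, smul_add]
  have hX (e : Fin n → Fin n ⊕ Fin n) : mapCoeff (PadicInt.Coe.ringHom (p := p))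
      (fun i => X (e i)) = fun i => X (e i) := funext fun i => map_X _ _
  rw [hX, hX]

theorem mulBy_agreeBelow_two (hL : IsTwistedLog p π h L) (hF : NoConst F)
    (hFL : comp L (mapCoeff PadicInt.Coe.ringHom F) =
      comp L (fun i => X (Sum.inl i)) + comp L (fun i => X (Sum.inr i))) (k : ℕ) (a : Fin n) :
    AgreeBelow 2 (mulBy F k a) (C (k : ℤ_[p]) * X a) := by
  refine hL.agreeBelow_two_of_comp_eq (hF.mulBy k) a (hL.comp_mapCoeff_mulBy hF hFL k) ?_
  have h1 := (hL.agreeBelow_two NoConst.X a).smul (k : ℚ_[p])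
  rw [comp_X] at h1
  rw [Pi.smul_apply, map_mul, map_C, map_X, map_natCast, ← smul_eq_C_mul,
    ← Nat.cast_smul_eq_nsmul ℚ_[p]]
  exact h1

/-- `[p]_F(X)_a ≡ X_{π(a)} ^ (p ^ h(a))` modulo `p`. -/
theorem prime_dvd_mulBy_sub (hL : IsTwistedLog p π h L) (hF : NoConst F)
    (hFL : comp L (mapCoeff PadicInt.Coe.ringHom F) =
      comp L (fun i => X (Sum.inl i)) + comp L (fun i => X (Sum.inr i))) (a : Fin n) :
    (p : MvPowerSeries (Fin n) ℤ_[p]) ∣ mulBy F p a - X (π a) ^ p ^ h a := by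
  have hφ : NoConst (fun a => X (π a) ^ p ^ h a : Fin n → MvPowerSeries (Fin n) ℤ_[p]) :=
    fun a => by rw [map_pow, constantCoeff_X, zero_pow (hL.pow_ne_zero a)]
  refine hL.dvd_sub_of_comp_sub_mem (hF.mulBy p) hφ (fun b d => ?_) a
  have hmap : mapCoeff (PadicInt.Coe.ringHom (p := p))
      (fun a => X (π a) ^ p ^ h a : Fin n → MvPowerSeries (Fin n) ℤ_[p]) =
        fun a => X (π a) ^ p ^ h a :=
    funext fun i => by rw [mapCoeff, map_pow, map_X]
  -- By `comp_twist` the difference `pL(X) - L(φ(X))` is exactly `pX`.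
  rw [hmap, hL.comp_mapCoeff_mulBy hF hFL, Pi.smul_apply, ← Nat.cast_smul_eq_nsmul ℚ_[p],
    ← hL.comp_twist b, add_sub_cancel_left, coeff_smul]
  obtain ⟨c, hc⟩ := coeff_X_mem (p := p) b d
  exact ⟨c, by rw [hc, pow_zero, one_mul, pow_one]⟩

end IsTwistedLog

/-! ### Power series as a module over the power series in powers of the variables -/

section PowerBasis

variable {σ k : Type*} [Fintype σ] [CommRing k] (π : Equiv.Perm σ) (q : σ → ℕ)

/-- The exponent of `∏ a, (X_{π(a)} ^ q(a)) ^ m(a)`. -/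
def twistExponent (m : σ → ℕ) : σ →₀ ℕ :=
  Finsupp.equivFunOnFinite.symm fun b => q (π.symm b) * m (π.symm b)

/-- The exponent of `∏ a, X_{π(a)} ^ r(a)`. -/
def residueExponent (r : ∀ a, Fin (q a)) : σ →₀ ℕ :=
  Finsupp.equivFunOnFinite.symm fun b => r (π.symm b)

theorem twistExponent_apply (m : σ → ℕ) (a : σ) : twistExponent π q m (π a) = q a * m a := by
  simp [twistExponent]

theorem residueExponent_apply (r : ∀ a, Fin (q a)) (a : σ) :
    residueExponent π q r (π a) = r a :=
  congrArg (fun b => (r b : ℕ)) (π.symm_apply_apply a)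

variable {π q}

/-- Uniqueness of division with remainder by `q a`, applied to the exponent of each `X_{π(a)}`. -/
theorem exponent_injective (hq : ∀ a, 0 < q a) {m m' : σ →₀ ℕ} {r r' : ∀ a, Fin (q a)}
    (h : twistExponent π q m + residueExponent π q r =
      twistExponent π q m' + residueExponent π q r') : m = m' ∧ r = r' := by
  have h1 : ∀ a, q a * m a + r a = q a * m' a + r' a := by
    intro a
    have h2 := DFunLike.congr_fun h (π a)
    simpa only [Finsupp.add_apply, twistExponent_apply, residueExponent_apply] using h2
  have h3 : ∀ a, (r a : ℕ) = r' a := by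
    intro a
    have h4 := congrArg (· % q a) (h1 a)
    simpa [Nat.mul_add_mod, Nat.mod_eq_of_lt (r a).2, Nat.mod_eq_of_lt (r' a).2] using h4
  refine ⟨Finsupp.ext fun a => ?_, funext fun a => Fin.ext (h3 a)⟩
  have h4 := h1 a
  rw [h3 a] at h4
  exact Nat.eq_of_mul_eq_mul_left (hq a) (Nat.add_right_cancel h4)

theorem exists_exponent (hq : ∀ a, 0 < q a) (e : σ →₀ ℕ) :
    ∃ (m : σ →₀ ℕ) (r : ∀ a, Fin (q a)), twistExponent π q m + residueExponent π q r = e := by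
  refine ⟨Finsupp.equivFunOnFinite.symm fun a => e (π a) / q a,
    fun a => ⟨e (π a) % q a, Nat.mod_lt _ (hq a)⟩, Finsupp.ext fun b => ?_⟩
  obtain ⟨a, rfl⟩ := π.surjective b
  rw [Finsupp.add_apply, twistExponent_apply, residueExponent_apply]
  exact Nat.div_add_mod _ _

theorem hasSubst_twist (hq : ∀ a, 0 < q a) :
    HasSubst (fun a => X (π a) ^ q a : σ → MvPowerSeries σ k) :=
  NoConst.hasSubst fun a => by rw [map_pow, constantCoeff_X, zero_pow (hq a).ne']

theorem prod_twist_eq_monomial (d : σ →₀ ℕ) :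
    (d.prod fun s e => (X (π s) ^ q s : MvPowerSeries σ k) ^ e) =
      monomial (twistExponent π q d) 1 := by
  rw [monomial_eq', map_one, one_mul, Finsupp.prod_fintype _ _ (fun _ => pow_zero _),
    Finsupp.prod_fintype _ _ (fun _ => pow_zero _), ← Equiv.prod_comp π fun b => X b ^ _]
  exact Finset.prod_congr rfl fun a _ => by rw [twistExponent_apply, pow_mul]

theorem coeff_subst_twist (hq : ∀ a, 0 < q a) (f : MvPowerSeries σ k) (m : σ →₀ ℕ) :
    coeff (twistExponent π q m) (f.subst (fun a => X (π a) ^ q a : σ → MvPowerSeries σ k)) =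
      coeff m f := by
  classical
  rw [coeff_subst (hasSubst_twist hq), finsum_eq_single _ m]
  · rw [prod_twist_eq_monomial, coeff_monomial_same, smul_eq_mul, mul_one]
  · intro d hd
    rw [prod_twist_eq_monomial, coeff_monomial_ne, smul_zero]
    intro h
    -- Distinct monomials stay distinct under the substitution: uniqueness of division, with all
    -- remainders zero.
    exact hd (exponent_injective (r := fun a => ⟨0, hq a⟩) (r' := fun a => ⟨0, hq a⟩) hq
      (congrArg (· + _) h)).1.symm

theorem coeff_subst_twist_of_ne (hq : ∀ a, 0 < q a) (f : MvPowerSeries σ k) {e : σ →₀ ℕ}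
    (he : ∀ m : σ →₀ ℕ, e ≠ twistExponent π q m) :
    coeff e (f.subst (fun a => X (π a) ^ q a : σ → MvPowerSeries σ k)) = 0 := by
  rw [coeff_subst (hasSubst_twist hq), finsum_eq_zero_of_forall_eq_zero]
  intro d
  rw [prod_twist_eq_monomial, coeff_monomial_ne (he d), smul_zero]

/-- Each monomial of the sum comes from exactly one remainder `r` and one exponent `m`, so the
series `f r` can be recovered independently of each other. -/
theorem coeff_sum_subst_twist (hq : ∀ a, 0 < q a) (f : (∀ a, Fin (q a)) → MvPowerSeries σ k)
    [Fintype (∀ a, Fin (q a))] (m : σ →₀ ℕ) (r : ∀ a, Fin (q a)) :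
    coeff (twistExponent π q m + residueExponent π q r)
      (∑ r', (f r').subst (fun a => X (π a) ^ q a : σ → MvPowerSeries σ k) *
        monomial (residueExponent π q r') 1) = coeff m (f r) := by
  rw [map_sum, Finset.sum_eq_single r]
  · rw [coeff_mul_monomial, if_pos le_add_self, add_tsub_cancel_right, mul_one,
      coeff_subst_twist hq]
  · intro r' _ hr
    rw [coeff_mul_monomial]
    split_ifs with hle
    · rw [coeff_subst_twist_of_ne hq, zero_mul]
      intro m' hm
      exact hr (exponent_injective hq ((tsub_eq_iff_eq_add_of_le hle).mp hm)).2.symm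
    · rfl
  · exact fun h => absurd (Finset.mem_univ _) h

/-- The monomials `∏ X_{π(a)}^{r(a)}` with `r(a) < q a` form a basis over the subring: the
coefficients of a series split into classes by remainder, and each class is one arbitrary series in
the `X_{π(a)}^{q a}`. -/
theorem module_range_substAlgHom_twist {k : Type*} [Field k] (hq : ∀ a, 0 < q a)
    {H : σ → MvPowerSeries σ k} (hH : HasSubst H) (hHq : H = fun a => X (π a) ^ q a) :
    Module.Finite (substAlgHom (R := k) hH).range (MvPowerSeries σ k) ∧
    Module.Free (substAlgHom (R := k) hH).range (MvPowerSeries σ k) ∧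
    Module.finrank (substAlgHom (R := k) hH).range (MvPowerSeries σ k) = ∏ a, q a := by
  classical
  subst hHq
  set S := (substAlgHom (R := k) hH).range
  let v : (∀ a, Fin (q a)) → MvPowerSeries σ k := fun r => monomial (residueExponent π q r) 1
  have hv : ∀ (c : (∀ a, Fin (q a)) → S) (f : (∀ a, Fin (q a)) → MvPowerSeries σ k),
      (∀ r, (c r : MvPowerSeries σ k) = (f r).subst fun a => X (π a) ^ q a) →
        ∀ (m : σ →₀ ℕ) r, coeff (twistExponent π q m + residueExponent π q r)
          (Fintype.linearCombination S v c) = coeff m (f r) := by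
    intro c f hcf m r
    rw [← coeff_sum_subst_twist (π := π) hq f m r, Fintype.linearCombination_apply]
    simp_rw [Subalgebra.smul_def, smul_eq_mul, hcf, v]
  have hbij : Function.Bijective (Fintype.linearCombination S v) := by
    constructor
    · rw [injective_iff_map_eq_zero]
      intro c hc
      have h1 : ∀ r, ∃ f : MvPowerSeries σ k, (c r : MvPowerSeries σ k) =
          f.subst fun a => X (π a) ^ q a := by
        intro r
        obtain ⟨f, hf⟩ := (c r).2
        exact ⟨f, hf.symm.trans (substAlgHom_apply hH f)⟩
      choose f hf using h1
      funext r
      have h2 : f r = 0 := by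
        ext m
        rw [← hv c f hf m r, hc, map_zero, map_zero]
      apply Subtype.ext
      rw [hf, h2, ← substAlgHom_apply hH, map_zero]
      rfl
    · intro g
      let f : (∀ a, Fin (q a)) → MvPowerSeries σ k := fun r m =>
        coeff (twistExponent π q m + residueExponent π q r) g
      refine ⟨fun r => ⟨substAlgHom hH (f r), ⟨f r, rfl⟩⟩, MvPowerSeries.ext fun e => ?_⟩
      obtain ⟨m, r, rfl⟩ := exists_exponent (π := π) hq e
      exact hv (fun r => ⟨substAlgHom hH (f r), ⟨f r, rfl⟩⟩) f
        (fun r => substAlgHom_apply hH (f r)) m r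
  let e := LinearEquiv.ofBijective _ hbij
  refine ⟨Module.Finite.equiv e, Module.Free.of_equiv e, ?_⟩
  rw [← e.finrank_eq, Module.finrank_fintype_fun_eq_card, Fintype.card_pi]
  simp_rw [Fintype.card_fin]

end PowerBasis

/-! ### The two-dimensional case -/

theorem isTwistedLog_logarithm (p : ℕ) [hp : Fact p.Prime] {h₁ h₂ : ℕ} (hh₁ : 0 < h₁)
    (hh₂ : 0 < h₂) :
    IsTwistedLog p (Equiv.swap (0 : Fin 2) 1) ![h₁, h₂] (logarithm p hh₁ hh₂) := by
  have hL : FunctionalEquation p h₁ h₂ (logarithm p hh₁ hh₂) :=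
    (functionalEquation_existsUnique p hh₁ hh₂).choose_spec.1
  obtain ⟨e0, e1⟩ := (functionalEquation_iff p hh₁ hh₂ _).mp hL
  refine ⟨Fin.forall_fin_two.mpr ⟨hh₁, hh₂⟩, ?_, Fin.forall_fin_two.mpr ⟨?_, ?_⟩⟩
  · set L := logarithm p hh₁ hh₂
    have hconst : ∀ (k : ℕ) (f : MvPowerSeries (Fin 2) ℚ_[p]), constantCoeff
        (f.subst (fun j : Fin 2 => X j ^ p ^ k : Fin 2 → MvPowerSeries (Fin 2) ℚ_[p])) =
          constantCoeff f := by
      intro k f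
      rw [← constantCoeff_expand (p ^ k) (pow_pos hp.out.pos k).ne' f, expand, substAlgHom_apply]
    have c0 := congrArg constantCoeff e0
    have c1 := congrArg constantCoeff e1
    rw [map_add, constantCoeff_X, zero_add, constantCoeff_smul, hconst, smul_eq_mul] at c0 c1
    have hp0 : (p : ℚ_[p]) ≠ 0 := Nat.cast_ne_zero.mpr hp.out.ne_zero
    have hp1 : (p : ℚ_[p]) * p - 1 ≠ 0 := by
      rw [sub_ne_zero]
      have h2 := hp.out.two_le
      exact_mod_cast (show p * p ≠ 1 by nlinarith)
    -- The two equations give `c = p⁻² c` for the constant term `c` of `L 0`, and `p² ≠ 1`.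
    have z0 : constantCoeff (L 0) = 0 := by
      rw [c1] at c0
      field_simp at c0
      exact (mul_eq_zero.mp (show ((p : ℚ_[p]) * p - 1) * constantCoeff (L 0) = 0 by
        linear_combination c0)).resolve_left hp1
    exact Fin.forall_fin_two.mpr ⟨z0, by rw [c1, z0, mul_zero]⟩
  · rw [Equiv.swap_apply_left]
    exact e0
  · rw [Equiv.swap_apply_right]
    exact e1

/-- Multiplication by `p` commutes with reduction, so over the residue field it is exactly the
monomial map, and the rank is `p^{h₁} p^{h₂}`. -/
theorem hasHeight_of_congrMod {p : ℕ} [hp : Fact p.Prime] {h₁ h₂ : ℕ}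
    {F : Fin 2 → MvPowerSeries (Fin 2 ⊕ Fin 2) ℤ_[p]} (hF : NoConst F)
    (hmod : CongrMod (p : ℤ_[p]) (mulBy F p) ![X 1 ^ p ^ h₁, X 0 ^ p ^ h₂]) :
    HasHeight p F (h₁ + h₂) := by
  have hsubst : HasSubst (mulBy (mapCoeff (IsLocalRing.residue ℤ_[p]) F) p) :=
    ((hF.map _).mulBy p).hasSubst
  have hred : mulBy (mapCoeff (IsLocalRing.residue ℤ_[p]) F) p =
      fun a => X (Equiv.swap (0 : Fin 2) 1 a) ^ p ^ (![h₁, h₂] a) := by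
    rw [← mapCoeff_mulBy _ hF]
    have h1 : ∀ a, mapCoeff (IsLocalRing.residue ℤ_[p]) (mulBy F p) a =
        map (IsLocalRing.residue ℤ_[p])
          ((![X 1 ^ p ^ h₁, X 0 ^ p ^ h₂] : Fin 2 → MvPowerSeries (Fin 2) ℤ_[p]) a) := by
      intro a
      ext d
      rw [mapCoeff, coeff_map, coeff_map, ← sub_eq_zero, ← map_sub, IsLocalRing.residue_eq_zero_iff,
        PadicInt.maximalIdeal_eq_span_p, Ideal.mem_span_singleton]
      exact hmod a d
    refine funext (Fin.forall_fin_two.mpr ⟨?_, ?_⟩)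
    · rw [h1, Equiv.swap_apply_left]
      simp
    · rw [h1, Equiv.swap_apply_right]
      simp
  obtain ⟨hfin, hfree, hrank⟩ := module_range_substAlgHom_twist
    (fun a => pow_pos hp.out.pos (![h₁, h₂] a)) hsubst hred
  refine ⟨hsubst, hfin, hfree, hrank.trans ?_⟩
  rw [Fin.prod_univ_two, pow_add]
  rfl

end LubinTateTwo

end

theorem proposition2p3 (p : ℕ) [Fact p.Prime] (h₁ h₂ : ℕ) (hh₁ : 0 < h₁) (hh₂ : 0 < h₂)
    (hcop : Nat.Coprime h₁ h₂) :
    ∃ F : Fin 2 → MvPowerSeries (Fin 2 ⊕ Fin 2) ℤ_[p],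
      LubinTateTwo.mapCoeff (PadicInt.Coe.ringHom (p := p)) F =
        LubinTateTwo.lubinTateGroup p hh₁ hh₂ ∧
      LubinTateTwo.IsFormalGroup F ∧
      LubinTateTwo.IsEndomorphism F (LubinTateTwo.mulBy F p) ∧
      LubinTateTwo.CongrModDegTwo (LubinTateTwo.mulBy F p)
        ![MvPowerSeries.C (p : ℤ_[p]) * MvPowerSeries.X 0,
          MvPowerSeries.C (p : ℤ_[p]) * MvPowerSeries.X 1] ∧
      LubinTateTwo.CongrMod (p : ℤ_[p]) (LubinTateTwo.mulBy F p)
        ![MvPowerSeries.X 1 ^ p ^ h₁, MvPowerSeries.X 0 ^ p ^ h₂] ∧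
      LubinTateTwo.mulBy F p ∈ LubinTateTwo.CLT p h₁ h₂ ∧
      LubinTateTwo.mulBy F p ∈ LubinTateTwo.CLTUnion p ∧
      LubinTateTwo.HasHeight p F (h₁ + h₂) := by
  have hL := LubinTateTwo.isTwistedLog_logarithm p hh₁ hh₂
  obtain ⟨F, hF, hFL⟩ := hL.exists_integral_formalGroup
  have hlin := hL.mulBy_agreeBelow_two hF hFL p
  have hmod : LubinTateTwo.CongrMod (p : ℤ_[p]) (LubinTateTwo.mulBy F p)
      ![MvPowerSeries.X 1 ^ p ^ h₁, MvPowerSeries.X 0 ^ p ^ h₂] := by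
    have h1 := fun a => LubinTateTwo.natCast_dvd_iff.mp (hL.prime_dvd_mulBy_sub hF hFL a)
    refine Fin.forall_fin_two.mpr ⟨fun d => ?_, fun d => ?_⟩
    · have h2 := h1 0 d
      rwa [Equiv.swap_apply_left, map_sub] at h2
    · have h2 := h1 1 d
      rwa [Equiv.swap_apply_right, map_sub] at h2
  have hCLT : LubinTateTwo.mulBy F p ∈ LubinTateTwo.CLT p h₁ h₂ := ⟨hlin, Or.inr hmod⟩
  refine ⟨F, ?_, hL.isFormalGroup hF hFL, hL.isEndomorphism_mulBy hF hFL p,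
    Fin.forall_fin_two.mpr ⟨hlin 0, hlin 1⟩, hmod, hCLT, ⟨h₁, h₂, hh₁, hh₂, hcop, hCLT⟩,
    LubinTateTwo.hasHeight_of_congrMod hF hmod⟩
  -- The integral `F` is the given group: apply `L⁻¹` to `L(F) = L(X) + L(Y)`.
  have hM := LubinTateTwo.isCompInverse_compInverse hL.exists_isCompInverse
  have hF' := hF.map (PadicInt.Coe.ringHom (p := p))
  rw [LubinTateTwo.lubinTateGroup, ← hFL, ← LubinTateTwo.comp_comp hL.noConst.hasSubst hF'.hasSubst,
    hM.2.2, LubinTateTwo.X_comp hF'.hasSubst]
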